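/- **Setting.** Let $d\in\{2,3\}$, let $\Omega\subset\mathbb R^d$ be open and connected, $X=H^1_0(\Omega)^d$ (the $H^1$-closure of the smooth vector fields with compact support in $\Omega$), $\|\cdot\|$ the $L^2$ norm, and $$b^*(v,w,z)=(v\cdot\nabla w,z)+\tfrac12((\nabla\cdot v)w,z),\qquad v,w,z\in X .$$ Let $M>0$ be a constant with $b^*(v,w,z)\le M\|\nabla v\|\|\nabla w\|\|\nabla z\|$ on $X$, let $\nu>0$, let $f\in H^{-1}(\Omega)$ (the dual of $X$ normed by $\|\nabla v\|$), $\|f\|_{-1}$ its dual norm, and $\sigma=M\nu^{-2}\|f\|_{-1}$. Let $Y$ be either the divergence-free space $V=\{v\in X:(\nabla\cdot v,q)=0\ \text{for all } q\in L^2(\Omega)\text{ of mean zero}\}$ or a finite-dimensional subspace of $X$ (a discrete velocity space). **Depth-2 AAPicard-Newton iteration.** Start from $u_0\in Y$. For $k\ge 0$, with damping factors $0<\beta_{k+1}\le1$: 1. $\tilde u_{k+1}\in Y$ satisfies $\nu(\nabla\tilde u_{k+1},\nabla v)+b^*(u_k,\tilde u_{k+1},v)=\langle f,v\rangle$ for all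 $v\in Y$. 2. With $w_n=\tilde u_n-u_{n-1}$, the reals $\alpha^1_{k+1},\alpha^2_{k+1}$ minimize over $(a,b)\in\mathbb R^2$ the norm $\|\nabla((1-a-b)w_{k+1}+a\,w_k+b\,w_{k-1})\|$. Coefficients of missing residuals are zero: $a=b=0$ for $k=0$, and $b=0$ for $k=1$. Put $$\hat u_{k+1}=\beta_{k+1}\big((1-\alpha^1_{k+1}-\alpha^2_{k+1})\tilde u_{k+1}+\alpha^1_{k+1}\tilde u_k+\alpha^2_{k+1}\tilde u_{k-1}\big)+(1-\beta_{k+1})\big((1-\alpha^1_{k+1}-\alpha^2_{k+1})u_k+\alpha^1_{k+1}u_{k-1}+\alpha^2_{k+1}u_{k-2}\big).$$ 3. $u_{k+1}\in Y$ satisfies $\nu(\nabla u_{k+1},\nabla v)+b^*(\hat u_{k+1},u_{k+1},v)+b^*(u_{k+1},\hat u_{k+1},v)-b^*(\hat u_{k+1},\hat u_{k+1},v)=\langle f,v\rangle$ for all $v\in Y$. The Anderson gains (with $0/0=0$) are $$\theta_{k,2}=\frac{\|\nabla((1-\alpha_k^1-\alpha_k^2)w_k+\alpha_k^1w_{k-1}+\alpha_k^2w_{k-2})\|}{\|\nabla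 w_k\|},\qquad \theta_k=\frac{\min_{a\in\mathbb R}\|\nabla((1-a)w_k+a\,w_{k-1})\|}{\|\nabla w_k\|}.$$ Write $e_j=\|\nabla(\tilde u_j-\hat u_{j-1})\|$ for $j\ge2$, and for $K>0$, $k\ge4$ let $$H_k(K)=\frac{\nu}{M}\Big(\sum_{j=2}^k\big(K\nu^{-1}M e_j\big)^{p_{k,j}}+\big(K\nu^{-1}M\|\nabla(u_1-u_0)\|\big)^{2^{\lfloor k/2\rfloor}}\Big),\qquad p_{k,j}=2^{\,2+\lfloor \max(k-1-j,0)/2\rfloor}.$$ All exponents in $H_k(K)$ are at least $4$. **Theorem.** Let $s<1$, $L>0$, $C_A>0$ with $sC_A\max\{1,L\}<1$. There are constants $C_k>0$ ($k\ge0$) and $c_0,C_0,K>0$, depending only on $s,L,C_A$ (so not on $d,\Omega,Y,M,\nu,f$ or the iterates), such that for all data as above with $\sigma\le s$ and every such iteration with $$|1-\alpha_n^1-\alpha_n^2|+|\alpha_n^1|+|\alpha_n^2|\le C_A,\qquad \|\nabla u_n\|\le L\nu^{-1}\|f\|_{-1}\qquad(n\ge1)$$ the following hold. (a) For every $k\ge4$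 with $\alpha_k^2\ne0$, $$e_{k+1}\le\frac{\nu^{-1}MC_{k-1}^{-2}C_k}{1-\sigma}\big(\beta_k\sigma\theta_{k,2}+(1-\beta_k)C_A\big)e_k^2+(1-\beta_k)\frac{C_A\nu^{-1}M}{1-\sigma}\sum_{j=k-2}^{k-1}C_{j-1}^{-2}e_j^2+H_k(K).$$ (b) There are numbers $r_j\in[c_0,C_0]$ with $e_{j+1}=r_j\|\nabla(u_j-\hat u_j)\|$ for all $j\ge1$, such that for every $k\ge4$ with $\alpha_k^2\ne0$, $$e_{k+1}\le\frac{\nu^{-1}Mr_{k-1}^{-2}r_k}{1-\sigma}\big(\beta_k\sigma\theta_{k,2}+(1-\beta_k)C_A\big)e_k^2+(1-\beta_k)\frac{C_A\nu^{-1}M}{1-\sigma}\sum_{j=k-2}^{k-1}r_kr_{j-1}^{-2}e_j^2+H_k(K).$$ (c) For every $k\ge4$ with $\alpha_k^2\ne0$ for which $\nabla(w_k-w_{k-1})$ and $\nabla(w_{k-1}-w_{k-2})$ are linearly independent, $\theta_{k,2}<\theta_k\le1$. -/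

import Mathlib

open MeasureTheory
open scoped ContDiff

noncomputable section

/-- The space `ℝ^d`, with its Euclidean norm. -/
abbrev Pt (d : ℕ) : Type := EuclideanSpace ℝ (Fin d)

/-- Real `d × d` matrices with the Frobenius inner product. -/
abbrev Mat (d : ℕ) : Type := EuclideanSpace ℝ (Fin d × Fin d)

/-- Square integrable vector fields on `Ω`. -/
abbrev L2Vec {d : ℕ} (Ω : Set (Pt d)) : Type := Lp (Pt d) 2 (volume.restrict Ω)

/-- Square integrable matrix fields on `Ω`. -/
abbrev L2Mat {d : ℕ} (Ω : Set (Pt d)) : Type := Lp (Mat d) 2 (volume.restrict Ω)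

/-- The Jacobian matrix of a vector field: the entry `(i, j)` is `∂φ_i / ∂x_j`. -/
def jacobian {d : ℕ} (φ : Pt d → Pt d) (x : Pt d) : Mat d :=
  WithLp.toLp 2 fun p => (fderiv ℝ φ x (EuclideanSpace.single p.2 1)) p.1

/-- The pairs `(φ, ∇φ)`, where `φ` is a smooth vector field with compact support in `Ω`. -/
def testGraph {d : ℕ} (Ω : Set (Pt d)) : Submodule ℝ (L2Vec Ω × L2Mat Ω) where
  carrier := {p | ∃ φ : Pt d → Pt d, ContDiff ℝ ∞ φ ∧ HasCompactSupport φ ∧ tsupport φ ⊆ Ω ∧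
    p.1 =ᵐ[volume.restrict Ω] φ ∧ p.2 =ᵐ[volume.restrict Ω] jacobian φ}
  zero_mem' := by
    refine ⟨0, contDiff_const, HasCompactSupport.zero, ?_, Lp.coeFn_zero _ _ _, ?_⟩
    · simp [tsupport]
    · have h : jacobian (0 : Pt d → Pt d) = 0 := by
        funext x
        ext p
        simp [jacobian]
      rw [h]
      exact Lp.coeFn_zero _ _ _
  add_mem' := by
    rintro p q ⟨φ, hφ, cφ, sφ, h1, h2⟩ ⟨ψ, hψ, cψ, sψ, h3, h4⟩
    refine ⟨φ + ψ, hφ.add hψ, cφ.add cψ,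
      (tsupport_add φ ψ).trans (Set.union_subset sφ sψ), ?_, ?_⟩
    · filter_upwards [Lp.coeFn_add p.1 q.1, h1, h3] with x hx a b
      exact hx.trans (congrArg₂ (· + ·) a b)
    · have h : jacobian (φ + ψ) = jacobian φ + jacobian ψ := by
        funext x
        ext p
        have e := fderiv_add (hφ.differentiable (by simp) x) (hψ.differentiable (by simp) x)
        simp [jacobian, e]
      rw [h]
      filter_upwards [Lp.coeFn_add p.2 q.2, h2, h4] with x hx a b
      exact hx.trans (congrArg₂ (· + ·) a b)
  smul_mem' := by
    rintro c p ⟨φ, hφ, cφ, sφ, h1, h2⟩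
    refine ⟨c • φ, hφ.const_smul c, cφ.smul_left (f := fun _ => c),
      (tsupport_smul_subset_right (fun _ => c) φ).trans sφ, ?_, ?_⟩
    · filter_upwards [Lp.coeFn_smul c p.1, h1] with x hx a
      simp [hx, a]
    · have h : jacobian (c • φ) = c • jacobian φ := by
        funext x
        ext p
        have e := fderiv_const_smul (hφ.differentiable (by simp) x) c
        simp [jacobian, e]
      rw [h]
      filter_upwards [Lp.coeFn_smul c p.2, h2] with x hx a
      simp [hx, a]

/-- The velocity space `X = H¹₀(Ω)^d`, the closure of the smooth compactly supported vector fields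
in the `H¹` topology. An element is recorded together with its weak gradient, as the pair
`(v, ∇v)` in `L² × L²`. -/
def H10 {d : ℕ} (Ω : Set (Pt d)) : Submodule ℝ (L2Vec Ω × L2Mat Ω) :=
  (testGraph Ω).topologicalClosure

/-- The underlying vector field of an element of `X`. -/
def val {d : ℕ} {Ω : Set (Pt d)} : H10 Ω →ₗ[ℝ] L2Vec Ω :=
  (LinearMap.fst ℝ (L2Vec Ω) (L2Mat Ω)).comp (H10 Ω).subtype

/-- The weak gradient; `‖grad v‖` is the norm `‖∇v‖` of `L²`. -/
def grad {d : ℕ} {Ω : Set (Pt d)} : H10 Ω →ₗ[ℝ] L2Mat Ω :=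
  (LinearMap.snd ℝ (L2Vec Ω) (L2Mat Ω)).comp (H10 Ω).subtype

/-- The divergence `∇ · v = ∑ i, ∂v_i / ∂x_i`. -/
def divergence {d : ℕ} {Ω : Set (Pt d)} (v : H10 Ω) (x : Pt d) : ℝ :=
  ∑ i, grad v x (i, i)

/-- The form `b*(v, w, z) = (v · ∇w, z) + ½ ((∇ · v) w, z)`. -/
def bstar {d : ℕ} {Ω : Set (Pt d)} (v w z : H10 Ω) : ℝ :=
  (∫ x in Ω, ∑ i, (∑ j, val v x j * grad w x (i, j)) * val z x i) +
    (1 / 2) * ∫ x in Ω, divergence v x * ∑ i, val w x i * val z x i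

/-- `M` is a constant in the estimate `b*(v, w, z) ≤ M ‖∇v‖ ‖∇w‖ ‖∇z‖` on `X`. -/
def IsTrilinearBound {d : ℕ} (Ω : Set (Pt d)) (M : ℝ) : Prop :=
  ∀ v w z : H10 Ω, bstar v w z ≤ M * ‖grad v‖ * ‖grad w‖ * ‖grad z‖

/-- `v` is divergence free: `(∇ · v, q) = 0` for all `q ∈ L²(Ω)` of mean zero. -/
def IsDivFree {d : ℕ} {Ω : Set (Pt d)} (v : H10 Ω) : Prop :=
  ∀ q : Lp ℝ 2 (volume.restrict Ω), (∫ x in Ω, q x) = 0 → (∫ x in Ω, divergence v x * q x) = 0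

/-- `f` lies in `H⁻¹(Ω)`, the dual of `X` normed by `‖∇v‖`. -/
def MemHMinusOne {d : ℕ} {Ω : Set (Pt d)} (f : H10 Ω →ₗ[ℝ] ℝ) : Prop :=
  ∃ F : ℝ, ∀ v, |f v| ≤ F * ‖grad v‖

/-- The dual norm `‖f‖₋₁`. -/
def hMinusOneNorm {d : ℕ} {Ω : Set (Pt d)} (f : H10 Ω →ₗ[ℝ] ℝ) : ℝ :=
  sInf {F : ℝ | 0 ≤ F ∧ ∀ v, |f v| ≤ F * ‖grad v‖}

/-- The number `σ = M ν⁻² ‖f‖₋₁`. -/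
def sigma {d : ℕ} {Ω : Set (Pt d)} (M ν : ℝ) (f : H10 Ω →ₗ[ℝ] ℝ) : ℝ :=
  M * (ν ^ 2)⁻¹ * hMinusOneNorm f

/-- The combination `(1 - a - b) x + a y + b z`. -/
def comb3 {d : ℕ} {Ω : Set (Pt d)} (a b : ℝ) (x y z : H10 Ω) : H10 Ω :=
  (1 - a - b) • x + a • y + b • z

/-- The Picard residual `w_n = ũ_n - u_{n-1}`, for `n ≥ 1`. -/
def picardResidual {d : ℕ} {Ω : Set (Pt d)} (ut u : ℕ → H10 Ω) (n : ℕ) : H10 Ω :=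
  ut n - u (n - 1)

/-- The averaged residual `(1 - a - b) w_n + a w_{n-1} + b w_{n-2}`. -/
def aaResidual {d : ℕ} {Ω : Set (Pt d)} (ut u : ℕ → H10 Ω) (n : ℕ) (a b : ℝ) : H10 Ω :=
  comb3 a b (picardResidual ut u n) (picardResidual ut u (n - 1)) (picardResidual ut u (n - 2))

/-- The sequences `ũ_n`, `û_n` (for `n ≥ 1`) and `u_n` (for `n ≥ 0`) are produced by the
AAPicard-Newton iteration of depth 2 in the space `Y`, with damping factors `β_n` and Anderson
coefficients `α_n^1, α_n^2`. In the first two steps, where fewer residuals are available, the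
depth is 0 and 1: coefficients of missing residuals are zero. -/
structure IsAAPicardNewton2 {d : ℕ} {Ω : Set (Pt d)} (Y : Submodule ℝ (H10 Ω)) (ν : ℝ)
    (f : H10 Ω →ₗ[ℝ] ℝ) (β α₁ α₂ : ℕ → ℝ) (ut uh u : ℕ → H10 Ω) : Prop where
  init_mem : u 0 ∈ Y
  picard_mem : ∀ k, ut (k + 1) ∈ Y
  picard : ∀ k, ∀ v ∈ Y,
    ν * inner ℝ (grad (ut (k + 1))) (grad v) + bstar (u k) (ut (k + 1)) v = f v
  damping : ∀ k, 0 < β (k + 1) ∧ β (k + 1) ≤ 1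
  start_one : α₁ 1 = 0
  start_two : α₂ 1 = 0 ∧ α₂ 2 = 0
  minimizes : ∀ k, ∀ a b : ℝ, (k = 0 → a = 0) → (k ≤ 1 → b = 0) →
    ‖grad (aaResidual ut u (k + 1) (α₁ (k + 1)) (α₂ (k + 1)))‖ ≤
      ‖grad (aaResidual ut u (k + 1) a b)‖
  mixing : ∀ k, uh (k + 1) =
    β (k + 1) • comb3 (α₁ (k + 1)) (α₂ (k + 1)) (ut (k + 1)) (ut k) (ut (k - 1)) +
      (1 - β (k + 1)) • comb3 (α₁ (k + 1)) (α₂ (k + 1)) (u k) (u (k - 1)) (u (k - 2))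
  newton_mem : ∀ k, u (k + 1) ∈ Y
  newton : ∀ k, ∀ v ∈ Y,
    ν * inner ℝ (grad (u (k + 1))) (grad v) + bstar (uh (k + 1)) (u (k + 1)) v +
      bstar (u (k + 1)) (uh (k + 1)) v - bstar (uh (k + 1)) (uh (k + 1)) v = f v

/-- The Anderson gain `θ_{n,2}` of depth 2 for the coefficients `a, b`. -/
def gain2 {d : ℕ} {Ω : Set (Pt d)} (ut u : ℕ → H10 Ω) (n : ℕ) (a b : ℝ) : ℝ :=
  ‖grad (aaResidual ut u n a b)‖ / ‖grad (picardResidual ut u n)‖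

/-- The Anderson gain `θ_n` of depth 1: the least value of `‖∇((1 - a) w_n + a w_{n-1})‖`
over real `a`, divided by `‖∇w_n‖`. -/
def gain1 {d : ℕ} {Ω : Set (Pt d)} (ut u : ℕ → H10 Ω) (n : ℕ) : ℝ :=
  (⨅ a : ℝ, ‖grad (aaResidual ut u n a 0)‖) / ‖grad (picardResidual ut u n)‖

/-- The size `‖∇(ũ_j - û_{j-1})‖`, for `j ≥ 2`. -/
def err {d : ℕ} {Ω : Set (Pt d)} (ut uh : ℕ → H10 Ω) (j : ℕ) : ℝ :=
  ‖grad (ut j - uh (j - 1))‖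

/-- The higher order terms in `{ũ_j - û_{j-1}}` for `2 ≤ j ≤ k` and in `u_1 - u_0`. For `k ≥ 4`
all powers are at least `4`; they are `4` for `j = k, k - 1, k - 2` and double each time `j`
goes down by two. -/
def higherOrder {d : ℕ} {Ω : Set (Pt d)} (K M ν : ℝ) (ut uh u : ℕ → H10 Ω) (k : ℕ) : ℝ :=
  ν * M⁻¹ *
    ((∑ j ∈ Finset.Icc 2 k, (K * (ν⁻¹ * M) * err ut uh j) ^ (2 ^ (2 + (k - 1 - j) / 2))) +
      (K * (ν⁻¹ * M) * ‖grad (u 1 - u 0)‖) ^ (2 ^ (k / 2)))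

end

/-!
The form `b*` is trilinear because `H¹₀ ⊂ L⁴` in dimensions two and three (`memLp_val_four`), so
that all the integrals converge. It is skew symmetric in its last two arguments by integration by
parts for test fields and density (`bstar_self`). After scaling, one is left with an abstract
problem: an inner product, a skew trilinear form with constant one, and a load of dual norm `σ`
(`IsNormalizedFlow`). Norms below are gradient norms in these units.

Let `D_k = u_k - û_k` be the Newton increment. The iterate `u_k` solves the nonlinear problem up to
the defect `b*(D_k, D_k, ·)`, hence `‖w_{k+1}‖ ≤ ‖D_k‖²` (`IsNewtonStep.norm_residual_le`). Two
consequences follow. The quantity `‖ũ_{k+1} - û_k‖` is equivalent to `‖D_k‖`, with constants that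
depend on `s` and `L` only (`IsNewtonStep.norm_le_mul`, `IsNewtonStep.norm_le_mul'`). And since the
Picard map is a `σ`-contraction, the increments `u_k - u_{k-1}` are quadratically small in
the `D_j` (`IsPicardStep.norm_sub_le`).

The residual of `û_k` in the nonlinear problem is an average of three residuals, in which the
Anderson coefficients sum to one. The differences between averages of products and products of
averages are therefore products of increments, which are quartic in the `D_j`. What remains is
`-β b*(y, û_k, ·)`, where `y` is the averaged Picard residual with `‖y‖ = θ ‖w_k‖`, and the average
of the defects `b*(D_j, D_j, ·)` with factor `1 - β` (`residual_average_eq`). The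
condition `s C_A max {1, L} < 1` bounds `û_k` below one, and makes the Newton problem coercive; this
gives `‖D_k‖ = O(∑ ‖D_j‖²)` (`IsMixedStep.norm_sub_le_quadratic`). With this, `û_k` can be
replaced by `ũ_{k+1}`, whose norm is at most `σ`, at the cost of quartic terms, and the sharp
factor `1 - σ` appears (`IsMixedStep.recursion`). The quartic terms are absorbed by the summands
`j = k - 2, k - 1, k` of the higher order terms.

The strict improvement of the gain is the uniqueness of the point of least norm in a convex set
(`IsAAPicardNewton2.gain2_lt_gain1`).
-/

noncomputable section

/-! ### Sobolev embedding -/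

theorem norm_fderiv_le_norm_jacobian {d : ℕ} (φ : Pt d → Pt d) (x : Pt d) :
    ‖fderiv ℝ φ x‖ ≤ ‖jacobian φ x‖ := by
  refine ContinuousLinearMap.opNorm_le_bound _ (norm_nonneg _) fun v => ?_
  have hv : fderiv ℝ φ x v =
      ∑ j, v j • fderiv ℝ φ x (EuclideanSpace.single j 1) := by
    conv_lhs => rw [← (EuclideanSpace.basisFun (Fin d) ℝ).sum_repr v]
    simp [map_sum]
  refine le_of_sq_le_sq ?_ (by positivity)
  rw [mul_pow, EuclideanSpace.norm_sq_eq, EuclideanSpace.norm_sq_eq, EuclideanSpace.norm_sq_eq,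
    Fintype.sum_prod_type, Finset.sum_mul]
  refine Finset.sum_le_sum fun i _ => ?_
  have h : fderiv ℝ φ x v i = ∑ j, jacobian φ x (i, j) * v j := by
    rw [hv]
    simp [jacobian, mul_comm]
  rw [h]
  simp only [Real.norm_eq_abs, sq_abs]
  exact Finset.sum_mul_sq_le_sq_mul_sq _ _ _

theorem support_jacobian_subset {d : ℕ} (φ : Pt d → Pt d) :
    Function.support (jacobian φ) ⊆ tsupport φ := by
  refine fun x hx => support_fderiv_subset ℝ (f := φ) fun h => hx ?_
  ext p
  simp [jacobian, h]

instance holderTriple_four_four_two : ENNReal.HolderTriple 4 4 2 where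
  inv_add_inv_eq_inv := by
    rw [← two_mul, show (4 : ENNReal) = 2 * 2 by norm_num,
      ENNReal.mul_inv (by simp) (by simp), ← mul_assoc, ENNReal.mul_inv_cancel (by simp) (by simp),
      one_mul]

/-- Sobolev's inequality in dimension three, `H¹ ⊂ L⁶`. -/
theorem eLpNorm_six_le :
    ∃ C : NNReal, ∀ φ : Pt 3 → Pt 3, ContDiff ℝ ∞ φ → HasCompactSupport φ →
      eLpNorm φ 6 volume ≤ C * eLpNorm (jacobian φ) 2 volume := by
  refine ⟨eLpNormLESNormFDerivOfEqInnerConst (volume : Measure (Pt 3)) 2, fun φ hφ cφ => ?_⟩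
  have h := eLpNorm_le_eLpNorm_fderiv_of_eq_inner (p := 2) (p' := 6) volume
    (hφ.of_le (by simp)) cφ (by norm_num) (by simp) (by simp; norm_num)
  refine h.trans (mul_le_mul_right ?_ _)
  exact eLpNorm_mono fun x => norm_fderiv_le_norm_jacobian φ x

/-- Ladyzhenskaya's inequality in dimension two: the endpoint Sobolev inequality `W¹·¹ ⊂ L²`,
applied to `|φ|²`. -/
theorem eLpNorm_four_sq_le : ∃ C : NNReal, ∀ φ : Pt 2 → Pt 2, ContDiff ℝ ∞ φ →
    HasCompactSupport φ →
      eLpNorm φ 4 volume ^ 2 ≤ C * (eLpNorm φ 2 volume * eLpNorm (jacobian φ) 2 volume) := by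
  refine ⟨eLpNormLESNormFDerivOneConst (volume : Measure (Pt 2)) 2 * 2, fun φ hφ cφ => ?_⟩
  have h1 := eLpNorm_le_eLpNorm_fderiv_one (p := 2) (u := fun x => ‖φ x‖ ^ 2) volume
    ((hφ.norm_sq ℝ).of_le (by simp)) (cφ.comp_left (g := fun y => ‖y‖ ^ 2) (by simp))
    (by simp; exact NNReal.HolderConjugate.two_two)
  have h2 := eLpNorm_norm_rpow (p := 2) (μ := volume) φ (q := 2) (by norm_num)
  have h3 : (2 : ENNReal) * ENNReal.ofReal 2 = 4 := by
    rw [show ENNReal.ofReal 2 = 2 by simp]; norm_num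
  simp only [Real.rpow_ofNat, ENNReal.rpow_ofNat, h3] at h2
  have h1' : eLpNorm (fun x => ‖φ x‖ ^ 2) 2 volume ≤ _ := h1
  rw [h2] at h1'
  refine h1'.trans ?_
  push_cast
  rw [mul_assoc]
  gcongr ?_ * ?_
  · exact le_rfl
  have h4 := eLpNorm_le_eLpNorm_mul_eLpNorm'_of_norm (p := 2) (q := 2) (r := 1) (μ := volume)
    (f := φ) (g := fderiv ℝ φ) hφ.continuous.aestronglyMeasurable
    (hφ.continuous_fderiv (by simp)).aestronglyMeasurable
    (fun y A => 2 • (innerSL ℝ y) ∘SL A) 2 (ae_of_all _ fun x => by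
      have := ContinuousLinearMap.opNorm_comp_le (innerSL ℝ (φ x)) (fderiv ℝ φ x)
      rw [innerSL_apply_norm] at this
      refine (norm_nsmul_le).trans ?_
      push_cast
      rw [mul_assoc]
      gcongr)
  have h5 : fderiv ℝ (fun x => ‖φ x‖ ^ 2) = fun x => 2 • (innerSL ℝ (φ x)) ∘SL fderiv ℝ φ x := by
    funext x
    exact ((hφ.differentiable (by simp) x).hasFDerivAt.norm_sq).fderiv
  rw [h5]
  refine h4.trans ?_
  rw [mul_assoc]
  gcongr ?_ * (_ * ?_)
  · simp
  · exact eLpNorm_mono fun x => norm_fderiv_le_norm_jacobian φ x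

/-- Elements of the closure of the test fields inherit a uniform `L^q` bound, by Fatou's lemma. -/
theorem memLp_val_of_bound {d : ℕ} {Ω : Set (Pt d)} {q : ENNReal} {C : NNReal}
    (h : ∀ p ∈ testGraph Ω, eLpNorm p.1 q (volume.restrict Ω) ≤ C * ‖p‖ₑ) (v : H10 Ω) :
    MemLp (val v) q (volume.restrict Ω) := by
  obtain ⟨p, hp, hlim⟩ := mem_closure_iff_seq_limit.1 v.2
  have hlim1 : Filter.Tendsto (fun n => (p n).1) Filter.atTop (nhds (val v)) :=
    (continuous_fst.tendsto _).comp hlim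
  obtain ⟨ns, hns, hae⟩ := (tendstoInMeasure_of_tendsto_Lp hlim1).exists_seq_tendsto_ae
  obtain ⟨R, hR⟩ := hlim.norm.bddAbove_range
  refine ⟨Lp.aestronglyMeasurable _, ?_⟩
  have hb : ∀ n, eLpNorm ((p (ns n)).1) q (volume.restrict Ω) ≤ C * ENNReal.ofReal R := by
    refine fun n => (h _ (hp _)).trans (mul_le_mul_right ?_ _)
    rw [← ofReal_norm]
    exact ENNReal.ofReal_le_ofReal (hR ⟨_, rfl⟩)
  calc eLpNorm (val v) q (volume.restrict Ω)
      ≤ Filter.liminf (fun n => eLpNorm ((p (ns n)).1) q (volume.restrict Ω)) Filter.atTop :=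
        Lp.eLpNorm_lim_le_liminf_eLpNorm (fun n => Lp.aestronglyMeasurable _) _ hae
    _ ≤ C * ENNReal.ofReal R := by
        refine Filter.liminf_le_of_le (by isBoundedDefault) fun b hb' => ?_
        obtain ⟨n, hn⟩ := hb'.exists
        exact hn.trans (hb n)
    _ < ⊤ := ENNReal.mul_lt_top (by simp) (by simp)

theorem enorm_fst_eq {d : ℕ} {Ω : Set (Pt d)} {p : L2Vec Ω × L2Mat Ω} {φ : Pt d → Pt d}
    (sφ : tsupport φ ⊆ Ω) (h : p.1 =ᵐ[volume.restrict Ω] φ) : ‖p.1‖ₑ = eLpNorm φ 2 volume := by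
  rw [Lp.enorm_def, eLpNorm_congr_ae h,
    eLpNorm_restrict_eq_of_support_subset ((subset_tsupport φ).trans sφ)]

theorem enorm_snd_eq {d : ℕ} {Ω : Set (Pt d)} {p : L2Vec Ω × L2Mat Ω} {φ : Pt d → Pt d}
    (sφ : tsupport φ ⊆ Ω) (h : p.2 =ᵐ[volume.restrict Ω] jacobian φ) :
    ‖p.2‖ₑ = eLpNorm (jacobian φ) 2 volume := by
  rw [Lp.enorm_def, eLpNorm_congr_ae h,
    eLpNorm_restrict_eq_of_support_subset ((support_jacobian_subset φ).trans sφ)]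

theorem enorm_fst_le {E F : Type*} [SeminormedAddCommGroup E] [SeminormedAddCommGroup F]
    (p : E × F) : ‖p.1‖ₑ ≤ ‖p‖ₑ := by
  rw [← ofReal_norm, ← ofReal_norm]
  exact ENNReal.ofReal_le_ofReal (norm_fst_le p)

theorem enorm_snd_le {E F : Type*} [SeminormedAddCommGroup E] [SeminormedAddCommGroup F]
    (p : E × F) : ‖p.2‖ₑ ≤ ‖p‖ₑ := by
  rw [← ofReal_norm, ← ofReal_norm]
  exact ENNReal.ofReal_le_ofReal (norm_snd_le p)

theorem memLp_four_of_two_six {α E : Type*} [MeasurableSpace α] [NormedAddCommGroup E]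
    {μ : Measure α} {f : α → E} (h2 : MemLp f 2 μ) (h6 : MemLp f 6 μ) : MemLp f 4 μ := by
  rw [← integrable_norm_rpow_iff h2.1 (by simp) (by simp)]
  have i2 := (integrable_norm_rpow_iff h2.1 (by simp) (by simp)).2 h2
  have i6 := (integrable_norm_rpow_iff h6.1 (by simp) (by simp)).2 h6
  simp only [ENNReal.toReal_ofNat, Real.rpow_ofNat] at i2 i6 ⊢
  refine (i2.add i6).mono' (h2.1.norm.pow 4) (ae_of_all _ fun x => ?_)
  rw [Real.norm_of_nonneg (by positivity)]
  have : 0 ≤ ‖f x‖ ^ 2 * (‖f x‖ ^ 2 - 1) ^ 2 := by positivity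
  have h4 : 0 ≤ ‖f x‖ ^ 4 := by positivity
  simp only [Pi.add_apply]
  nlinarith

/-- The embedding `H¹₀ ⊂ L⁴` in dimensions two and three. -/
theorem memLp_val_four {d : ℕ} (hd : d = 2 ∨ d = 3) {Ω : Set (Pt d)} (v : H10 Ω) :
    MemLp (val v) 4 (volume.restrict Ω) := by
  rcases hd with rfl | rfl
  · obtain ⟨C, hC⟩ := eLpNorm_four_sq_le
    refine memLp_val_of_bound (C := NNReal.sqrt C) ?_ v
    rintro p ⟨φ, hφ, cφ, sφ, h1, h2⟩
    rw [eLpNorm_congr_ae h1, eLpNorm_restrict_eq_of_support_subset ((subset_tsupport φ).trans sφ)]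
    refine (ENNReal.pow_le_pow_left_iff two_ne_zero).1 ((hC φ hφ cφ).trans ?_)
    rw [mul_pow, ← ENNReal.coe_pow, NNReal.sq_sqrt, sq ‖p‖ₑ, ← enorm_fst_eq sφ h1,
      ← enorm_snd_eq sφ h2]
    gcongr
    · exact enorm_fst_le p
    · exact enorm_snd_le p
  · obtain ⟨C, hC⟩ := eLpNorm_six_le
    refine memLp_four_of_two_six (Lp.memLp _) (memLp_val_of_bound (C := C) ?_ v)
    rintro p ⟨φ, hφ, cφ, sφ, h1, h2⟩
    rw [eLpNorm_congr_ae h1, eLpNorm_restrict_eq_of_support_subset ((subset_tsupport φ).trans sφ)]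
    refine (hC φ hφ cφ).trans ?_
    rw [← enorm_snd_eq sφ h2]
    gcongr
    exact enorm_snd_le p

/-! ### Trilinearity and skew symmetry of the convective form -/

theorem integrable_coord_mul_coord_mul {d : ℕ} {Ω : Set (Pt d)} (hd : d = 2 ∨ d = 3)
    (v w z : H10 Ω) (i k : Fin d) (p : Fin d × Fin d) :
    IntegrableOn (fun x => val v x i * val z x k * grad w x p) Ω := by
  have hv := (EuclideanSpace.proj i : Pt d →L[ℝ] ℝ).comp_memLp' (memLp_val_four hd v)
  have hz := (EuclideanSpace.proj k : Pt d →L[ℝ] ℝ).comp_memLp' (memLp_val_four hd z)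
  have hw := (EuclideanSpace.proj p : Mat d →L[ℝ] ℝ).comp_memLp' (Lp.memLp (grad w))
  exact MemLp.integrable_mul (p := 2) (q := 2) (hz.mul' (r := 2) hv) hw

theorem integrable_convection {d : ℕ} {Ω : Set (Pt d)} (hd : d = 2 ∨ d = 3) (v w z : H10 Ω) :
    IntegrableOn (fun x => ∑ i, (∑ j, val v x j * grad w x (i, j)) * val z x i) Ω := by
  refine integrable_finsetSum _ fun i _ => ?_
  simp only [Finset.sum_mul]
  refine integrable_finsetSum _ fun j _ => ?_
  refine (integrable_coord_mul_coord_mul hd v w z j i (i, j)).congr (ae_of_all _ fun x => ?_)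
  simp only
  ring

theorem integrable_divergence {d : ℕ} {Ω : Set (Pt d)} (hd : d = 2 ∨ d = 3) (v w z : H10 Ω) :
    IntegrableOn (fun x => divergence v x * ∑ i, val w x i * val z x i) Ω := by
  simp only [Finset.mul_sum]
  refine integrable_finsetSum _ fun i _ => ?_
  simp only [divergence, Finset.sum_mul]
  refine integrable_finsetSum _ fun j _ => ?_
  refine (integrable_coord_mul_coord_mul hd w v z i i (j, j)).congr (ae_of_all _ fun x => ?_)
  simp only
  ring

theorem val_add_ae {d : ℕ} {Ω : Set (Pt d)} (v w : H10 Ω) :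
    ∀ᵐ x ∂volume.restrict Ω, val (v + w) x = val v x + val w x := by
  rw [map_add]
  exact Lp.coeFn_add _ _

theorem grad_add_ae {d : ℕ} {Ω : Set (Pt d)} (v w : H10 Ω) :
    ∀ᵐ x ∂volume.restrict Ω, grad (v + w) x = grad v x + grad w x := by
  rw [map_add]
  exact Lp.coeFn_add _ _

theorem val_smul_ae {d : ℕ} {Ω : Set (Pt d)} (c : ℝ) (v : H10 Ω) :
    ∀ᵐ x ∂volume.restrict Ω, val (c • v) x = c • val v x := by
  rw [map_smul]
  exact Lp.coeFn_smul _ _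

theorem grad_smul_ae {d : ℕ} {Ω : Set (Pt d)} (c : ℝ) (v : H10 Ω) :
    ∀ᵐ x ∂volume.restrict Ω, grad (c • v) x = c • grad v x := by
  rw [map_smul]
  exact Lp.coeFn_smul _ _

theorem bstar_eq_integral {d : ℕ} {Ω : Set (Pt d)} (hd : d = 2 ∨ d = 3) (v w z : H10 Ω) :
    bstar v w z = ∫ x in Ω, ((∑ i, (∑ j, val v x j * grad w x (i, j)) * val z x i) +
      (1 / 2) * (divergence v x * ∑ i, val w x i * val z x i)) := by
  rw [bstar, ← integral_const_mul,
    integral_add (integrable_convection hd v w z) ((integrable_divergence hd v w z).const_mul _)]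

theorem integrable_bstar {d : ℕ} {Ω : Set (Pt d)} (hd : d = 2 ∨ d = 3) (v w z : H10 Ω) :
    IntegrableOn (fun x => (∑ i, (∑ j, val v x j * grad w x (i, j)) * val z x i) +
      (1 / 2) * (divergence v x * ∑ i, val w x i * val z x i)) Ω :=
  (integrable_convection hd v w z).add ((integrable_divergence hd v w z).const_mul _)

theorem bstar_add_left {d : ℕ} {Ω : Set (Pt d)} (hd : d = 2 ∨ d = 3) (v v' w z : H10 Ω) :
    bstar (v + v') w z = bstar v w z + bstar v' w z := by
  simp only [bstar_eq_integral hd]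
  rw [← integral_add (integrable_bstar hd v w z) (integrable_bstar hd v' w z)]
  refine integral_congr_ae ?_
  filter_upwards [val_add_ae v v', grad_add_ae v v'] with x h1 h2
  simp only [h1, h2, divergence, PiLp.add_apply, add_mul, Finset.sum_add_distrib]
  ring

theorem bstar_add_middle {d : ℕ} {Ω : Set (Pt d)} (hd : d = 2 ∨ d = 3) (v w w' z : H10 Ω) :
    bstar v (w + w') z = bstar v w z + bstar v w' z := by
  simp only [bstar_eq_integral hd]
  rw [← integral_add (integrable_bstar hd v w z) (integrable_bstar hd v w' z)]
  refine integral_congr_ae ?_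
  filter_upwards [val_add_ae w w', grad_add_ae w w'] with x h1 h2
  simp only [h1, h2, divergence, PiLp.add_apply, add_mul, mul_add, Finset.sum_add_distrib]
  ring

theorem bstar_add_right {d : ℕ} {Ω : Set (Pt d)} (hd : d = 2 ∨ d = 3) (v w z z' : H10 Ω) :
    bstar v w (z + z') = bstar v w z + bstar v w z' := by
  simp only [bstar_eq_integral hd]
  rw [← integral_add (integrable_bstar hd v w z) (integrable_bstar hd v w z')]
  refine integral_congr_ae ?_
  filter_upwards [val_add_ae z z'] with x h1
  simp only [h1, PiLp.add_apply, mul_add, Finset.sum_add_distrib]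
  ring

theorem bstar_smul_left {d : ℕ} {Ω : Set (Pt d)} (hd : d = 2 ∨ d = 3) (c : ℝ) (v w z : H10 Ω) :
    bstar (c • v) w z = c * bstar v w z := by
  simp only [bstar_eq_integral hd]
  rw [← integral_const_mul]
  refine integral_congr_ae ?_
  filter_upwards [val_smul_ae c v, grad_smul_ae c v] with x h1 h2
  simp only [h1, h2, divergence, PiLp.smul_apply, smul_eq_mul, mul_assoc, ← Finset.mul_sum]
  ring

theorem bstar_smul_middle {d : ℕ} {Ω : Set (Pt d)} (hd : d = 2 ∨ d = 3) (c : ℝ)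
    (v w z : H10 Ω) : bstar v (c • w) z = c * bstar v w z := by
  simp only [bstar_eq_integral hd]
  rw [← integral_const_mul]
  refine integral_congr_ae ?_
  filter_upwards [val_smul_ae c w, grad_smul_ae c w] with x h1 h2
  simp only [h1, h2, PiLp.smul_apply, smul_eq_mul, mul_left_comm _ c, mul_assoc,
    ← Finset.mul_sum]
  ring

theorem bstar_smul_right {d : ℕ} {Ω : Set (Pt d)} (hd : d = 2 ∨ d = 3) (c : ℝ)
    (v w z : H10 Ω) : bstar v w (c • z) = c * bstar v w z := by
  simp only [bstar_eq_integral hd]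
  rw [← integral_const_mul]
  refine integral_congr_ae ?_
  filter_upwards [val_smul_ae c z] with x h1
  simp only [h1, PiLp.smul_apply, smul_eq_mul, mul_left_comm _ c, ← Finset.mul_sum]
  ring

/-- The form `b*(v, w, z)` as a trilinear map. -/
def bstarLin {d : ℕ} {Ω : Set (Pt d)} (hd : d = 2 ∨ d = 3) :
    H10 Ω →ₗ[ℝ] H10 Ω →ₗ[ℝ] H10 Ω →ₗ[ℝ] ℝ :=
  LinearMap.mk₂ ℝ
    (fun v w =>
      { toFun := bstar v w
        map_add' := bstar_add_right hd v w
        map_smul' := fun c z => bstar_smul_right hd c v w z })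
    (fun v v' w => LinearMap.ext fun z => bstar_add_left hd v v' w z)
    (fun c v w => LinearMap.ext fun z => bstar_smul_left hd c v w z)
    (fun v w w' => LinearMap.ext fun z => bstar_add_middle hd v w w' z)
    (fun c v w => LinearMap.ext fun z => bstar_smul_middle hd c v w z)

@[simp]
theorem bstarLin_apply {d : ℕ} {Ω : Set (Pt d)} (hd : d = 2 ∨ d = 3) (v w z : H10 Ω) :
    bstarLin hd v w z = bstar v w z := rfl

theorem abs_bstar_le {d : ℕ} {Ω : Set (Pt d)} (hd : d = 2 ∨ d = 3) {M : ℝ}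
    (hM : IsTrilinearBound Ω M) (v w z : H10 Ω) :
    |bstar v w z| ≤ M * ‖grad v‖ * ‖grad w‖ * ‖grad z‖ := by
  refine abs_le.2 ⟨?_, hM v w z⟩
  have h := hM ((-1 : ℝ) • v) w z
  rw [bstar_smul_left hd, map_smul, norm_smul] at h
  simp only [norm_neg, norm_one, one_mul, neg_mul] at h
  linarith

theorem norm_grad_le {d : ℕ} {Ω : Set (Pt d)} (v : H10 Ω) : ‖grad v‖ ≤ ‖v‖ :=
  norm_snd_le (v : L2Vec Ω × L2Mat Ω)

/-- Integration by parts: `b*(φ, ψ, ψ)` is half the integral of the divergence of `|ψ|² φ`. -/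
theorem bstar_self_of_mem_testGraph {d : ℕ} {Ω : Set (Pt d)} (hd : d = 2 ∨ d = 3) {v w : H10 Ω}
    (hv : (v : L2Vec Ω × L2Mat Ω) ∈ testGraph Ω) (hw : (w : L2Vec Ω × L2Mat Ω) ∈ testGraph Ω) :
    bstar v w w = 0 := by
  obtain ⟨φ, hφ, cφ, sφ, h1, h2⟩ := hv
  obtain ⟨ψ, hψ, cψ, sψ, h3, h4⟩ := hw
  let e : Fin d → Pt d := fun j => EuclideanSpace.single j 1
  let g : Pt d → ℝ := fun x => ‖ψ x‖ ^ 2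
  let a : Fin d → Pt d → ℝ := fun j x => φ x j
  have ha : ∀ j, ContDiff ℝ ∞ (a j) := fun j =>
    (EuclideanSpace.proj j : Pt d →L[ℝ] ℝ).contDiff.comp hφ
  have hg : ContDiff ℝ ∞ g := hψ.norm_sq ℝ
  have cg : HasCompactSupport g := cψ.comp_left (g := fun y => ‖y‖ ^ 2) (by simp)
  have dψ : ∀ x, DifferentiableAt ℝ ψ x := hψ.differentiable (by simp)
  have dφ : ∀ x, DifferentiableAt ℝ φ x := hφ.differentiable (by simp)
  have da : ∀ j x, fderiv ℝ (a j) x (e j) = fderiv ℝ φ x (e j) j := fun j x => by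
    have := ((EuclideanSpace.proj j : Pt d →L[ℝ] ℝ).hasFDerivAt.comp x (dφ x).hasFDerivAt).fderiv
    exact congrArg (fun T : Pt d →L[ℝ] ℝ => T (e j)) this
  have dg : ∀ j x, fderiv ℝ g x (e j) = 2 * ∑ i, ψ x i * fderiv ℝ ψ x (e j) i := fun j x => by
    rw [((dψ x).hasFDerivAt.norm_sq).fderiv]
    simp [PiLp.inner_apply, mul_comm]
  -- all three products are continuous with compact support
  have ca : ∀ j, Continuous fun x => fderiv ℝ (a j) x (e j) := fun j =>
    ((ha j).continuous_fderiv (by simp)).clm_apply continuous_const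
  have cdg : ∀ j, Continuous fun x => fderiv ℝ g x (e j) := fun j =>
    (hg.continuous_fderiv (by simp)).clm_apply continuous_const
  have i1 : ∀ j, Integrable (fun x => fderiv ℝ (a j) x (e j) * g x) := fun j =>
    ((ca j).mul hg.continuous).integrable_of_hasCompactSupport cg.mul_left
  have i2 : ∀ j, Integrable (fun x => a j x * fderiv ℝ g x (e j)) := fun j =>
    ((ha j).continuous.mul (cdg j)).integrable_of_hasCompactSupport
      ((cg.fderiv_apply (𝕜 := ℝ) (e j)).mul_left)
  have i3 : ∀ j, Integrable (fun x => a j x * g x) := fun j =>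
    ((ha j).continuous.mul hg.continuous).integrable_of_hasCompactSupport cg.mul_left
  have ibp : ∀ j, ∫ x, (a j x * fderiv ℝ g x (e j) + fderiv ℝ (a j) x (e j) * g x) = 0 := by
    intro j
    rw [integral_add (i2 j) (i1 j), integral_mul_fderiv_eq_neg_fderiv_mul_of_integrable (i1 j)
      (i2 j) (i3 j) (fun x _ => (ha j).differentiable (by simp) x)
      (fun x _ => hg.differentiable (by simp) x), neg_add_cancel]
  have key : bstar v w w = ∫ x in Ω, ∑ j, (1 / 2) *
      (a j x * fderiv ℝ g x (e j) + fderiv ℝ (a j) x (e j) * g x) := by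
    rw [bstar_eq_integral hd]
    refine integral_congr_ae ?_
    filter_upwards [h1, h2, h3, h4] with x e1 e2 e3 e4
    have e1' : val v x = φ x := e1
    have e2' : grad v x = jacobian φ x := e2
    have e3' : val w x = ψ x := e3
    have e4' : grad w x = jacobian ψ x := e4
    have hgx : g x = ∑ i, ψ x i * ψ x i := by
      simp only [g]
      rw [EuclideanSpace.norm_sq_eq]
      simp [sq]
    simp only [divergence, e1', e2', e3', e4', jacobian, da, dg, ← Finset.mul_sum,
      Finset.sum_add_distrib, ← Finset.sum_mul, ← hgx, mul_add]
    congr 1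
    simp only [Finset.sum_mul, a]
    rw [Finset.sum_comm, Finset.mul_sum]
    refine Finset.sum_congr rfl fun j _ => ?_
    rw [mul_left_comm, ← mul_assoc (1 / 2 : ℝ) 2, one_div, inv_mul_cancel₀ two_ne_zero, one_mul,
      Finset.mul_sum]
    refine Finset.sum_congr rfl fun i _ => ?_
    ring
  rw [key, setIntegral_eq_integral_of_forall_compl_eq_zero, integral_finsetSum]
  · refine Finset.sum_eq_zero fun j _ => ?_
    rw [integral_const_mul, ibp j, mul_zero]
  · exact fun j _ => ((i2 j).add (i1 j)).const_mul _
  · intro x hx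
    have h0 : ψ x = 0 := image_eq_zero_of_notMem_tsupport fun h => hx (sψ h)
    refine Finset.sum_eq_zero fun j _ => ?_
    rw [dg]
    simp [g, h0]

/-- The set of test fields, as a subset of `X`, is dense. -/
theorem dense_testGraph {d : ℕ} (Ω : Set (Pt d)) :
    Dense {v : H10 Ω | (v : L2Vec Ω × L2Mat Ω) ∈ testGraph Ω} := by
  refine Subtype.dense_iff.2 fun p hp => closure_mono (fun q hq => ?_) hp
  exact ⟨⟨q, (testGraph Ω).le_topologicalClosure hq⟩, hq, rfl⟩

/-- Skew symmetry of `b*` in its last two arguments. -/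
theorem bstar_self {d : ℕ} {Ω : Set (Pt d)} (hd : d = 2 ∨ d = 3) {M : ℝ} (hM0 : 0 < M)
    (hM : IsTrilinearBound Ω M) (v w : H10 Ω) : bstar v w w = 0 := by
  have hb : ∀ v w z : H10 Ω, |bstar v w z| ≤ M * ‖v‖ * ‖w‖ * ‖z‖ := fun v w z =>
    (abs_bstar_le hd hM v w z).trans (by gcongr <;> exact norm_grad_le _)
  have c1 : ∀ w : H10 Ω, Continuous fun v : H10 Ω => bstar v w w := fun w =>
    (LinearMap.mkContinuous (((bstarLin hd).flip w).flip w) (M * ‖w‖ * ‖w‖) fun v => by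
      refine (hb v w w).trans (le_of_eq (by ring))).continuous
  have c2 : ∀ v : H10 Ω, Continuous fun w : H10 Ω => bstar v w w := fun v =>
    let B := LinearMap.mkContinuous₂ (bstarLin hd v) (M * ‖v‖) fun w z => hb v w z
    (B.continuous.clm_apply continuous_id : Continuous fun w => B w w)
  have s1 : ∀ w : H10 Ω, (w : L2Vec Ω × L2Mat Ω) ∈ testGraph Ω → ∀ v, bstar v w w = 0 :=
    fun w hw v => (dense_testGraph Ω).induction
      (P := fun v => bstar v w w = 0) (fun v hv => bstar_self_of_mem_testGraph hd hv hw)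
      (isClosed_eq (c1 w) continuous_const) v
  exact (dense_testGraph Ω).induction (P := fun w => bstar v w w = 0)
    (fun w hw => s1 w hw v) (isClosed_eq (c2 v) continuous_const) w

/-! ### Picard and Newton steps in normalized units -/

section AbstractFlow

variable {X E : Type*} [AddCommGroup X] [Module ℝ X] [NormedAddCommGroup E]
  [InnerProductSpace ℝ E]

/-- The data of a stationary Navier-Stokes problem in units where the viscosity and the constant
of the trilinear estimate are one: `‖G v‖` plays the role of `‖∇v‖`, the form `B` is skew
symmetric in its last two arguments and bounded by one, and the load `F` has dual norm at most
`σ`. -/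
structure IsNormalizedFlow (G : X →ₗ[ℝ] E) (B : X →ₗ[ℝ] X →ₗ[ℝ] X →ₗ[ℝ] ℝ) (F : X → ℝ)
    (σ : ℝ) : Prop where
  abs_le : ∀ u v w, |B u v w| ≤ ‖G u‖ * ‖G v‖ * ‖G w‖
  self : ∀ u v, B u v v = 0
  load_le : ∀ v, |F v| ≤ σ * ‖G v‖
  nonneg : 0 ≤ σ

/-- `t ∈ Y` is the result of a Picard step from `u`. -/
structure IsPicardStep (G : X →ₗ[ℝ] E) (B : X →ₗ[ℝ] X →ₗ[ℝ] X →ₗ[ℝ] ℝ) (F : X → ℝ)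
    (Y : Submodule ℝ X) (u t : X) : Prop where
  mem : t ∈ Y
  eq : ∀ v ∈ Y, inner ℝ (G t) (G v) + B u t v = F v

/-- `u ∈ Y` is the result of a Newton step from `h ∈ Y`. -/
structure IsNewtonStep (G : X →ₗ[ℝ] E) (B : X →ₗ[ℝ] X →ₗ[ℝ] X →ₗ[ℝ] ℝ) (F : X → ℝ)
    (Y : Submodule ℝ X) (h u : X) : Prop where
  mem_left : h ∈ Y
  mem : u ∈ Y
  eq : ∀ v ∈ Y, inner ℝ (G u) (G v) + B h u v + B u h v - B h h v = F v

theorem le_of_sq_le_mul_self {x K : ℝ} (hx : 0 ≤ x) (hK : 0 ≤ K) (h : x ^ 2 ≤ K * x) : x ≤ K := by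
  rcases hx.eq_or_lt with rfl | hx
  · exact hK
  · exact le_of_mul_le_mul_right (by linarith [sq x]) hx

variable {G : X →ₗ[ℝ] E} {B : X →ₗ[ℝ] X →ₗ[ℝ] X →ₗ[ℝ] ℝ} {F : X → ℝ} {σ : ℝ}
  {Y : Submodule ℝ X}

theorem IsPicardStep.norm_le (hB : IsNormalizedFlow G B F σ) {u t : X}
    (ht : IsPicardStep G B F Y u t) : ‖G t‖ ≤ σ := by
  refine le_of_sq_le_mul_self (norm_nonneg _) hB.nonneg ?_
  have h := ht.eq t ht.mem
  rw [hB.self, add_zero, real_inner_self_eq_norm_sq] at h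
  rw [h]
  exact (le_abs_self _).trans (hB.load_le t)

/-- The Newton equation, with its quadratic defect displayed: a Newton step from `h` to `u` solves
the nonlinear equation up to `B(u - h, u - h, ·)`. -/
theorem IsNewtonStep.eq_defect {h u : X} (hu : IsNewtonStep G B F Y h u) {v : X} (hv : v ∈ Y) :
    F v = inner ℝ (G u) (G v) + B u u v - B (u - h) (u - h) v := by
  rw [← hu.eq v hv]
  simp only [map_sub, LinearMap.sub_apply]
  ring

/-- A Picard step that follows a Newton step has a quadratically small residual. -/
theorem IsNewtonStep.norm_residual_le (hB : IsNormalizedFlow G B F σ) {h u t : X}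
    (hu : IsNewtonStep G B F Y h u) (ht : IsPicardStep G B F Y u t) :
    ‖G (t - u)‖ ≤ ‖G (u - h)‖ ^ 2 := by
  have hw : t - u ∈ Y := Y.sub_mem ht.mem hu.mem
  refine le_of_sq_le_mul_self (norm_nonneg _) (by positivity) ?_
  have e1 := ht.eq _ hw
  rw [hu.eq_defect hw] at e1
  have e2 : ‖G (t - u)‖ ^ 2 = -B (u - h) (u - h) (t - u) := by
    have e3 := hB.self u (t - u)
    rw [← real_inner_self_eq_norm_sq]
    nth_rewrite 1 [map_sub G t u]
    rw [inner_sub_left]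
    simp only [map_sub, LinearMap.sub_apply] at e1 e3 ⊢
    linarith
  rw [e2]
  have := hB.abs_le (u - h) (u - h) (t - u)
  have := neg_abs_le (B (u - h) (u - h) (t - u))
  nlinarith

/-- The two residuals `u - h` and `t - h` of a Newton step and the following Picard step are
related by `(G(t - h), G v) + B(u, t - h, v) = (G(u - h), G v) + B(h, u - h, v)`. -/
theorem IsNewtonStep.residual_eq {h u t : X} (hu : IsNewtonStep G B F Y h u)
    (ht : IsPicardStep G B F Y u t) {v : X} (hv : v ∈ Y) :
    inner ℝ (G (t - h)) (G v) + B u (t - h) v =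
      inner ℝ (G (u - h)) (G v) + B h (u - h) v := by
  have e1 := ht.eq v hv
  have e2 := hu.eq v hv
  simp only [map_sub, LinearMap.sub_apply, inner_sub_left] at e1 e2 ⊢
  linarith

theorem IsNewtonStep.norm_le_mul (hB : IsNormalizedFlow G B F σ) {h u t : X}
    (hu : IsNewtonStep G B F Y h u) (ht : IsPicardStep G B F Y u t) :
    ‖G (u - h)‖ ≤ (1 + ‖G u‖) * ‖G (t - h)‖ := by
  refine le_of_sq_le_mul_self (norm_nonneg _) (by positivity) ?_
  have e := hu.residual_eq ht (Y.sub_mem hu.mem hu.mem_left)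
  rw [hB.self, add_zero, real_inner_self_eq_norm_sq] at e
  rw [← e]
  have h1 := real_inner_le_norm (G (t - h)) (G (u - h))
  have h2 := (le_abs_self _).trans (hB.abs_le u (t - h) (u - h))
  linarith

/-- For small `u - h` the quadratic bound on `t - u` is used, for large `u - h` the bound on `t`
and `u`, so no bound on `h` is needed. -/
theorem IsNewtonStep.norm_le_mul' (hB : IsNormalizedFlow G B F σ) {h u t : X}
    (hu : IsNewtonStep G B F Y h u) (ht : IsPicardStep G B F Y u t) :
    ‖G (t - h)‖ ≤ (2 + σ + ‖G u‖) * ‖G (u - h)‖ := by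
  have h1 : ‖G (t - h)‖ ≤ ‖G (t - u)‖ + ‖G (u - h)‖ := by
    rw [← sub_add_sub_cancel t u h, map_add]
    exact norm_add_le _ _
  have h2 := hu.norm_residual_le hB ht
  have h3 : ‖G (t - u)‖ ≤ σ + ‖G u‖ := by
    rw [map_sub]
    exact (norm_sub_le _ _).trans (by linarith [ht.norm_le hB])
  have h4 := hB.nonneg
  have h5 := norm_nonneg (G u)
  have h6 := norm_nonneg (G (u - h))
  rcases le_total (‖G (u - h)‖) 1 with h7 | h7 <;> nlinarith

/-- The Picard map is a `σ`-contraction, so its increments are controlled by its residuals. -/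
theorem IsPicardStep.norm_sub_le (hB : IsNormalizedFlow G B F σ) {u t u' t' : X}
    (ht : IsPicardStep G B F Y u t) (ht' : IsPicardStep G B F Y u' t') :
    (1 - σ) * ‖G (u' - u)‖ ≤ ‖G (t' - u')‖ + ‖G (t - u)‖ := by
  have h1 : ‖G (t' - t)‖ ≤ σ * ‖G (u' - u)‖ := by
    have hm := Y.sub_mem ht'.mem ht.mem
    refine le_of_sq_le_mul_self (norm_nonneg _) (mul_nonneg hB.nonneg (norm_nonneg _)) ?_
    have e1 := ht.eq _ hm
    have e2 := ht'.eq _ hm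
    have e3 : ‖G (t' - t)‖ ^ 2 = -B (u' - u) t (t' - t) := by
      have e4 := hB.self u' (t' - t)
      rw [← real_inner_self_eq_norm_sq]
      nth_rewrite 1 [map_sub G t' t]
      rw [inner_sub_left]
      simp only [map_sub, LinearMap.sub_apply] at e1 e2 e4 ⊢
      linarith
    rw [e3]
    have h2 := hB.abs_le (u' - u) t (t' - t)
    have h3 := neg_abs_le (B (u' - u) t (t' - t))
    have h4 : ‖G (u' - u)‖ * ‖G t‖ * ‖G (t' - t)‖ ≤ ‖G (u' - u)‖ * σ * ‖G (t' - t)‖ := by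
      gcongr
      exact ht.norm_le hB
    linarith
  have h2 : ‖G (u' - u)‖ ≤ ‖G (t' - t)‖ + (‖G (t' - u')‖ + ‖G (t - u)‖) := by
    rw [show u' - u = (t' - t) + (-(t' - u') + (t - u)) by abel, map_add, map_add, map_neg]
    refine (norm_add_le _ _).trans (add_le_add_right ((norm_add_le _ _).trans ?_) _)
    rw [norm_neg]
  linarith

/-- The residual of the averaged and damped iterate `h = x + β y` in the nonlinear equation. Here
`x` is the average of the `u_i`, `y` that of the Picard residuals `t_i - u_i`, and the weights are
`1 - a - b, a, b`. Because the weights sum to one, the averages of products differ from products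
of averages by terms in the increments `u_i - u_0` and `(t_i - u_i) - (t_0 - u_0)` only. -/
theorem residual_average_eq {h₀ h₁ h₂ u₀ u₁ u₂ t₀ t₁ t₂ x y h v : X} {a b β : ℝ}
    (hu₀ : IsNewtonStep G B F Y h₀ u₀) (hu₁ : IsNewtonStep G B F Y h₁ u₁)
    (hu₂ : IsNewtonStep G B F Y h₂ u₂) (ht₀ : IsPicardStep G B F Y u₀ t₀)
    (ht₁ : IsPicardStep G B F Y u₁ t₁) (ht₂ : IsPicardStep G B F Y u₂ t₂)
    (hx : x = (1 - a - b) • u₀ + a • u₁ + b • u₂)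
    (hy : y = (1 - a - b) • (t₀ - u₀) + a • (t₁ - u₁) + b • (t₂ - u₂))
    (hh : h = x + β • y) (hv : v ∈ Y) :
    F v - inner ℝ (G h) (G v) - B h h v =
      (a * B (u₁ - u₀) (u₁ - u₀) v + b * B (u₂ - u₀) (u₂ - u₀) v -
          B (a • (u₁ - u₀) + b • (u₂ - u₀)) (a • (u₁ - u₀) + b • (u₂ - u₀)) v) +
        β * (a * B (u₁ - u₀) ((t₁ - u₁) - (t₀ - u₀)) v +
            b * B (u₂ - u₀) ((t₂ - u₂) - (t₀ - u₀)) v -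
            B (a • (u₁ - u₀) + b • (u₂ - u₀))
              (a • ((t₁ - u₁) - (t₀ - u₀)) + b • ((t₂ - u₂) - (t₀ - u₀))) v) -
        β * B y h v -
        (1 - β) * ((1 - a - b) * B (u₀ - h₀) (u₀ - h₀) v + a * B (u₁ - h₁) (u₁ - h₁) v +
          b * B (u₂ - h₂) (u₂ - h₂) v) := by
  have n₀ := hu₀.eq_defect hv
  have n₁ := hu₁.eq_defect hv
  have n₂ := hu₂.eq_defect hv
  have p₀ := ht₀.eq v hv
  have p₁ := ht₁.eq v hv
  have p₂ := ht₂.eq v hv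
  have q₀ : B (u₀ - h₀) (u₀ - h₀) v = inner ℝ (G u₀) (G v) + B u₀ u₀ v - F v := by linarith
  have q₁ : B (u₁ - h₁) (u₁ - h₁) v = inner ℝ (G u₁) (G v) + B u₁ u₁ v - F v := by linarith
  have q₂ : B (u₂ - h₂) (u₂ - h₂) v = inner ℝ (G u₂) (G v) + B u₂ u₂ v - F v := by linarith
  rw [q₀, q₁, q₂]
  subst hh hx hy
  simp only [map_sub, map_add, map_smul, LinearMap.sub_apply, LinearMap.add_apply,
    LinearMap.smul_apply, inner_sub_left, inner_add_left, real_inner_smul_left, smul_eq_mul]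
  linear_combination (-β * (1 - a - b)) * p₀ + (-β * a) * p₁ + (-β * b) * p₂

/-- The difference between the average of `B(p_i, p'_i, v)` and `B` at the averages is quadratic
in the size of the increments. -/
theorem IsNormalizedFlow.abs_covariance_le (hB : IsNormalizedFlow G B F σ) {p q p' q' v : X}
    {a b C P P' : ℝ} (hab : |a| + |b| ≤ C) (hp : ‖G p‖ ≤ P) (hq : ‖G q‖ ≤ P)
    (hp' : ‖G p'‖ ≤ P') (hq' : ‖G q'‖ ≤ P') :
    |a * B p p' v + b * B q q' v - B (a • p + b • q) (a • p' + b • q') v| ≤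
      (C + C ^ 2) * (P * P') * ‖G v‖ := by
  have hP : 0 ≤ P := (norm_nonneg _).trans hp
  have hP' : 0 ≤ P' := (norm_nonneg _).trans hp'
  have hC : 0 ≤ C := by linarith [abs_nonneg a, abs_nonneg b]
  have avg : ∀ {p q : X} {P : ℝ}, 0 ≤ P → ‖G p‖ ≤ P → ‖G q‖ ≤ P → ‖G (a • p + b • q)‖ ≤ C * P := by
    intro p q P hP hp hq
    rw [map_add, map_smul, map_smul]
    refine (norm_add_le _ _).trans ?_
    rw [norm_smul, norm_smul, Real.norm_eq_abs, Real.norm_eq_abs]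
    calc |a| * ‖G p‖ + |b| * ‖G q‖ ≤ |a| * P + |b| * P := by gcongr
      _ = (|a| + |b|) * P := by ring
      _ ≤ C * P := by gcongr
  have h1 : |B p p' v| ≤ P * P' * ‖G v‖ := (hB.abs_le _ _ _).trans (by gcongr)
  have h2 : |B q q' v| ≤ P * P' * ‖G v‖ := (hB.abs_le _ _ _).trans (by gcongr)
  have h3 : |B (a • p + b • q) (a • p' + b • q') v| ≤ (C * P) * (C * P') * ‖G v‖ :=
    (hB.abs_le _ _ _).trans (by
      gcongr
      · exact avg hP hp hq
      · exact avg hP' hp' hq')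
  calc _ ≤ |a * B p p' v + b * B q q' v| + |B (a • p + b • q) (a • p' + b • q') v| := abs_sub _ _
    _ ≤ |a| * |B p p' v| + |b| * |B q q' v| + |B (a • p + b • q) (a • p' + b • q') v| := by
        rw [← abs_mul, ← abs_mul]
        gcongr
        exact abs_add_le _ _
    _ ≤ |a| * (P * P' * ‖G v‖) + |b| * (P * P' * ‖G v‖) + (C * P) * (C * P') * ‖G v‖ := by
        gcongr
    _ = (|a| + |b|) * (P * P' * ‖G v‖) + (C * P) * (C * P') * ‖G v‖ := by ring
    _ ≤ C * (P * P' * ‖G v‖) + (C * P) * (C * P') * ‖G v‖ := by gcongr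
    _ = _ := by ring

end AbstractFlow

/-! ### The recursion for one accelerated step -/

section OneStep

variable {X E : Type*} [AddCommGroup X] [Module ℝ X] [NormedAddCommGroup E]
  [InnerProductSpace ℝ E] {G : X →ₗ[ℝ] E} {B : X →ₗ[ℝ] X →ₗ[ℝ] X →ₗ[ℝ] ℝ} {F : X → ℝ}
  {σ : ℝ} {Y : Submodule ℝ X}

/-- The factor of the quartic terms that come from averaging the nonlinearity. -/
def averagingConst (s C : ℝ) : ℝ := (C + C ^ 2) * ((2 / (1 - s)) ^ 2 + 2 / (1 - s))

/-- A bound on `‖∇(u_k - û_k)‖` (in normalized units). -/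
def sizeConst (s L C : ℝ) : ℝ := L * s + s * C * max 1 L

/-- The factor in the bound of `‖∇(u_k - û_k)‖` by the squares of its three predecessors. -/
def quadraticConst (s L C : ℝ) : ℝ :=
  (averagingConst s C + C + 1) / (1 - s * C * max 1 L) + sizeConst s L C

/-- The factor of all quartic terms in the recursion for `‖∇(u_k - û_k)‖`. -/
def quarticConst (s L C : ℝ) : ℝ :=
  averagingConst s C + sizeConst s L C * quadraticConst s L C ^ 2 +
    (2 + s + L * s) * quadraticConst s L C

/-- One step of the accelerated iteration, in normalized units: `u` is the Newton iterate from the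
mixed point `h`, which is built from the three previous Newton iterates `u₀, u₁, u₂` (with
predictors `h₀, h₁, h₂`) and the Picard iterates `t₀, t₁, t₂` from them. The vector `y` is the
averaged Picard residual. -/
structure IsMixedStep (G : X →ₗ[ℝ] E) (B : X →ₗ[ℝ] X →ₗ[ℝ] X →ₗ[ℝ] ℝ) (F : X → ℝ)
    (Y : Submodule ℝ X) (R C β a b : ℝ) (h₀ h₁ h₂ u₀ u₁ u₂ t₀ t₁ t₂ y h u t : X) : Prop where
  newton₀ : IsNewtonStep G B F Y h₀ u₀
  newton₁ : IsNewtonStep G B F Y h₁ u₁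
  newton₂ : IsNewtonStep G B F Y h₂ u₂
  picard₀ : IsPicardStep G B F Y u₀ t₀
  picard₁ : IsPicardStep G B F Y u₁ t₁
  picard₂ : IsPicardStep G B F Y u₂ t₂
  residual : y = (1 - a - b) • (t₀ - u₀) + a • (t₁ - u₁) + b • (t₂ - u₂)
  mixed : h = ((1 - a - b) • u₀ + a • u₁ + b • u₂) + β • y
  newton : IsNewtonStep G B F Y h u
  picard : IsPicardStep G B F Y u t
  nonneg : 0 ≤ β
  le_one : β ≤ 1
  coeff : |1 - a - b| + |a| + |b| ≤ C
  optimal : ‖G y‖ ≤ ‖G (t₀ - u₀)‖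
  size₀ : ‖G u₀‖ ≤ R
  size₁ : ‖G u₁‖ ≤ R
  size₂ : ‖G u₂‖ ≤ R
  size : ‖G u‖ ≤ R

variable {s L R C β a b : ℝ} {h₀ h₁ h₂ u₀ u₁ u₂ t₀ t₁ t₂ y h u t : X}

/-- Testing the equation for `D = u - h` with `D` itself. The increments `u_i - u_0` are bounded by
Picard residuals, hence quadratically in the `u_i - h_i`, so that their products are quartic. -/
theorem IsMixedStep.energy_le (hB : IsNormalizedFlow G B F σ) (hσ : σ ≤ s) (hs : s < 1)
    (hm : IsMixedStep G B F Y R C β a b h₀ h₁ h₂ u₀ u₁ u₂ t₀ t₁ t₂ y h u t) :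
    ‖G (u - h)‖ ^ 2 + B (u - h) h (u - h) + β * B y h (u - h) ≤
      (averagingConst s C *
          (‖G (u₀ - h₀)‖ ^ 2 + ‖G (u₁ - h₁)‖ ^ 2 + ‖G (u₂ - h₂)‖ ^ 2) ^ 2 +
        (1 - β) * (|1 - a - b| * ‖G (u₀ - h₀)‖ ^ 2 + |a| * ‖G (u₁ - h₁)‖ ^ 2 +
          |b| * ‖G (u₂ - h₂)‖ ^ 2)) * ‖G (u - h)‖ := by
  have hD : u - h ∈ Y := Y.sub_mem hm.newton.mem hm.newton.mem_left
  have key := residual_average_eq hm.newton₀ hm.newton₁ hm.newton₂ hm.picard₀ hm.picard₁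
    hm.picard₂ rfl hm.residual hm.mixed hD
  have r₀ := hm.newton₀.norm_residual_le hB hm.picard₀
  have r₁ := hm.newton₁.norm_residual_le hB hm.picard₁
  have r₂ := hm.newton₂.norm_residual_le hB hm.picard₂
  have test : ‖G (u - h)‖ ^ 2 + B (u - h) h (u - h) =
      F (u - h) - inner ℝ (G h) (G (u - h)) - B h h (u - h) := by
    have e := hm.newton.eq _ hD
    have e2 := hB.self h (u - h)
    rw [← real_inner_self_eq_norm_sq]
    nth_rewrite 1 [map_sub G u h]
    rw [inner_sub_left]
    simp only [map_sub, LinearMap.sub_apply] at e e2 ⊢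
    linarith
  rw [← test] at key
  set D := u - h
  set d₀ := ‖G (u₀ - h₀)‖ ^ 2
  set d₁ := ‖G (u₁ - h₁)‖ ^ 2
  set d₂ := ‖G (u₂ - h₂)‖ ^ 2
  have n₀ : 0 ≤ d₀ := by positivity
  have n₁ : 0 ≤ d₁ := by positivity
  have n₂ : 0 ≤ d₂ := by positivity
  have hs' : 0 < 1 - s := by linarith
  have inc : ∀ {u' t' : X} {d' : ℝ}, IsPicardStep G B F Y u' t' → ‖G (t' - u')‖ ≤ d' →
      ‖G (u' - u₀)‖ ≤ (d' + d₀) / (1 - s) := by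
    intro u' t' d' hp hd
    rw [le_div_iff₀ hs', mul_comm]
    have := hm.picard₀.norm_sub_le hB hp
    have : (1 - s) * ‖G (u' - u₀)‖ ≤ (1 - σ) * ‖G (u' - u₀)‖ := by gcongr
    linarith
  have winc : ∀ {u' t' : X} {d' : ℝ}, ‖G (t' - u')‖ ≤ d' →
      ‖G ((t' - u') - (t₀ - u₀))‖ ≤ d' + d₀ := by
    intro u' t' d' hd
    rw [map_sub]
    exact (norm_sub_le _ _).trans (add_le_add hd r₀)
  set S := d₀ + d₁ + d₂ with hS
  have hSn : 0 ≤ S := by positivity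
  have toP : ∀ {d' : ℝ}, d' + d₀ ≤ S → (d' + d₀) / (1 - s) ≤ 2 / (1 - s) * S := by
    intro d' hd
    rw [div_mul_eq_mul_div]
    gcongr
    linarith
  have c₁ : d₁ + d₀ ≤ S := by linarith
  have c₂ : d₂ + d₀ ≤ S := by linarith
  have hab : |a| + |b| ≤ C := by linarith [hm.coeff, abs_nonneg (1 - a - b)]
  have hP₁ := (inc hm.picard₁ r₁).trans (toP c₁)
  have hP₂ := (inc hm.picard₂ r₂).trans (toP c₂)
  have e₁ := (le_abs_self _).trans (hB.abs_covariance_le (v := D) hab hP₁ hP₂ hP₁ hP₂)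
  have e₂ := (le_abs_self _).trans (hB.abs_covariance_le (v := D) hab hP₁ hP₂
    ((winc r₁).trans c₁) ((winc r₂).trans c₂))
  have hC : 0 ≤ C := by linarith [abs_nonneg a, abs_nonneg b]
  have e₃ := mul_le_mul_of_nonneg_left e₂ hm.nonneg
  have e₄ : β * ((C + C ^ 2) * (2 / (1 - s) * S * S) * ‖G D‖) ≤
      (C + C ^ 2) * (2 / (1 - s) * S * S) * ‖G D‖ :=
    mul_le_of_le_one_left (by positivity) hm.le_one
  have quad : ∀ (c : ℝ) (z : X), -(c * B z z D) ≤ |c| * ‖G z‖ ^ 2 * ‖G D‖ := by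
    intro c z
    calc -(c * B z z D) ≤ |c * B z z D| := neg_le_abs _
      _ = |c| * |B z z D| := abs_mul _ _
      _ ≤ |c| * (‖G z‖ * ‖G z‖ * ‖G D‖) := by gcongr; exact hB.abs_le _ _ _
      _ = _ := by ring
  have q := mul_le_mul_of_nonneg_left (add_le_add (add_le_add (quad (1 - a - b) (u₀ - h₀))
    (quad a (u₁ - h₁))) (quad b (u₂ - h₂))) (sub_nonneg.2 hm.le_one)
  have final : averagingConst s C * S ^ 2 * ‖G D‖ =
      (C + C ^ 2) * (2 / (1 - s) * S * (2 / (1 - s) * S)) * ‖G D‖ +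
        (C + C ^ 2) * (2 / (1 - s) * S * S) * ‖G D‖ := by
    rw [averagingConst]
    ring
  rw [add_mul, final]
  simp only [d₀, d₁, d₂]
  linarith

theorem IsMixedStep.norm_mixed_le (hB : IsNormalizedFlow G B F σ) (hσ : σ ≤ s)
    (hm : IsMixedStep G B F Y (L * σ) C β a b h₀ h₁ h₂ u₀ u₁ u₂ t₀ t₁ t₂ y h u t) :
    ‖G h‖ ≤ s * C * max 1 L := by
  have hσ0 := hB.nonneg
  have hC : 0 ≤ C := by
    linarith [hm.coeff, abs_nonneg (1 - a - b), abs_nonneg a, abs_nonneg b]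
  have mid : ∀ {u' t' : X}, IsPicardStep G B F Y u' t' → ‖G u'‖ ≤ L * σ →
      ‖G (u' + β • (t' - u'))‖ ≤ max 1 L * σ := by
    intro u' t' hp hu'
    have e : u' + β • (t' - u') = β • t' + (1 - β) • u' := by module
    have h1 : ‖G t'‖ ≤ max 1 L * σ :=
      (hp.norm_le hB).trans (le_mul_of_one_le_left hσ0 (le_max_left _ _))
    have h2 : ‖G u'‖ ≤ max 1 L * σ := hu'.trans (by gcongr; exact le_max_right _ _)
    rw [e, map_add, map_smul, map_smul]
    refine (norm_add_le _ _).trans ?_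
    rw [norm_smul, norm_smul, Real.norm_of_nonneg hm.nonneg,
      Real.norm_of_nonneg (sub_nonneg.2 hm.le_one)]
    have := mul_le_mul_of_nonneg_left h1 hm.nonneg
    have := mul_le_mul_of_nonneg_left h2 (sub_nonneg.2 hm.le_one)
    linarith
  have e : h = (1 - a - b) • (u₀ + β • (t₀ - u₀)) + a • (u₁ + β • (t₁ - u₁)) +
      b • (u₂ + β • (t₂ - u₂)) := by
    rw [hm.mixed, hm.residual]
    module
  rw [e, map_add, map_add, map_smul, map_smul, map_smul]
  refine (norm_add₃_le).trans ?_
  simp only [norm_smul, Real.norm_eq_abs]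
  have m₀ := mul_le_mul_of_nonneg_left (mid hm.picard₀ hm.size₀) (abs_nonneg (1 - a - b))
  have m₁ := mul_le_mul_of_nonneg_left (mid hm.picard₁ hm.size₁) (abs_nonneg a)
  have m₂ := mul_le_mul_of_nonneg_left (mid hm.picard₂ hm.size₂) (abs_nonneg b)
  have hmx : 0 ≤ max 1 L := zero_le_one.trans (le_max_left _ _)
  calc _ ≤ (|1 - a - b| + |a| + |b|) * (max 1 L * σ) := by linarith
    _ ≤ C * (max 1 L * s) := by gcongr; exact hm.coeff
    _ = _ := by ring

theorem IsMixedStep.norm_sub_le_size (hB : IsNormalizedFlow G B F σ) (hσ : σ ≤ s) (hL : 0 ≤ L)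
    (hm : IsMixedStep G B F Y (L * σ) C β a b h₀ h₁ h₂ u₀ u₁ u₂ t₀ t₁ t₂ y h u t) :
    ‖G (u - h)‖ ≤ sizeConst s L C := by
  rw [map_sub, sizeConst]
  refine (norm_sub_le _ _).trans (add_le_add (hm.size.trans ?_) (hm.norm_mixed_le hB hσ))
  gcongr

theorem averagingConst_nonneg (hs : s < 1) (hC : 0 ≤ C) : 0 ≤ averagingConst s C := by
  have : 0 < 1 - s := by linarith
  unfold averagingConst
  positivity

/-- Here the condition `s C max {1, L} < 1` makes the Newton linearization at `h` coercive. -/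
theorem IsMixedStep.norm_sub_le_quadratic (hB : IsNormalizedFlow G B F σ) (hσ : σ ≤ s) (hs : s < 1)
    (hL : 0 ≤ L) (hsC : s * C * max 1 L < 1)
    (hm : IsMixedStep G B F Y (L * σ) C β a b h₀ h₁ h₂ u₀ u₁ u₂ t₀ t₁ t₂ y h u t) :
    ‖G (u - h)‖ ≤ quadraticConst s L C *
      (‖G (u₀ - h₀)‖ ^ 2 + ‖G (u₁ - h₁)‖ ^ 2 + ‖G (u₂ - h₂)‖ ^ 2) := by
  have en := hm.energy_le hB hσ hs
  have hh := hm.norm_mixed_le hB hσ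
  have hsize := hm.norm_sub_le_size hB hσ hL
  have hy := hm.optimal.trans (hm.newton₀.norm_residual_le hB hm.picard₀)
  have hs0 : 0 ≤ s := hB.nonneg.trans hσ
  have hβ := hm.nonneg
  have hβ' := hm.le_one
  have hcoeff := hm.coeff
  have ha0 := abs_nonneg (1 - a - b)
  have ha1 := abs_nonneg a
  have ha2 := abs_nonneg b
  have hC : 0 ≤ C := by linarith
  have hη : 0 < 1 - s * C * max 1 L := by linarith
  have hA := averagingConst_nonneg hs hC
  have hSz : 0 ≤ sizeConst s L C := (norm_nonneg _).trans hsize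
  set D := u - h
  set d₀ := ‖G (u₀ - h₀)‖ ^ 2
  set d₁ := ‖G (u₁ - h₁)‖ ^ 2
  set d₂ := ‖G (u₂ - h₂)‖ ^ 2
  have n₀ : 0 ≤ d₀ := by positivity
  have n₁ : 0 ≤ d₁ := by positivity
  have n₂ : 0 ≤ d₂ := by positivity
  set S := d₀ + d₁ + d₂ with hS
  have hSn : 0 ≤ S := by positivity
  set η := s * C * max 1 L
  have b1 : -(B D h D) ≤ η * ‖G D‖ ^ 2 := by
    calc -(B D h D) ≤ |B D h D| := neg_le_abs _
      _ ≤ ‖G D‖ * ‖G h‖ * ‖G D‖ := hB.abs_le _ _ _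
      _ ≤ ‖G D‖ * η * ‖G D‖ := by gcongr
      _ = _ := by ring
  have b2 : -(β * B y h D) ≤ S * ‖G D‖ := by
    calc -(β * B y h D) ≤ |β * B y h D| := neg_le_abs _
      _ = β * |B y h D| := by rw [abs_mul, abs_of_nonneg hβ]
      _ ≤ 1 * (‖G y‖ * ‖G h‖ * ‖G D‖) := by gcongr; exact hB.abs_le _ _ _
      _ ≤ 1 * (S * 1 * ‖G D‖) := by gcongr <;> linarith
      _ = _ := by ring
  have b3 : (1 - β) * (|1 - a - b| * d₀ + |a| * d₁ + |b| * d₂) ≤ C * S := by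
    have i0 : |1 - a - b| * d₀ ≤ C * d₀ := by gcongr; linarith
    have i1 : |a| * d₁ ≤ C * d₁ := by gcongr; linarith
    have i2 : |b| * d₂ ≤ C * d₂ := by gcongr; linarith
    calc _ ≤ 1 * (C * d₀ + C * d₁ + C * d₂) := by gcongr; linarith
      _ = _ := by ring
  have b4 : ‖G D‖ ≤ (averagingConst s C * S ^ 2 + C * S + S) / (1 - η) := by
    rw [le_div_iff₀ hη]
    have hsq : ((1 - η) * ‖G D‖) ^ 2 ≤
        ((1 - η) * (averagingConst s C * S ^ 2 + C * S + S)) * ‖G D‖ := by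
      have : (1 - η) * ‖G D‖ ^ 2 ≤ (averagingConst s C * S ^ 2 + C * S + S) * ‖G D‖ := by
        have := mul_le_mul_of_nonneg_right b3 (norm_nonneg (G D))
        linarith
      calc ((1 - η) * ‖G D‖) ^ 2 = (1 - η) * ((1 - η) * ‖G D‖ ^ 2) := by ring
        _ ≤ (1 - η) * ((averagingConst s C * S ^ 2 + C * S + S) * ‖G D‖) := by gcongr
        _ = _ := by ring
    rw [mul_comm]
    refine le_of_sq_le_mul_self (by positivity) (by positivity) (hsq.trans (le_of_eq (by ring)))
  rw [quadraticConst, add_mul]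
  rcases le_total S 1 with h1 | h1
  · have hS2 : S ^ 2 ≤ S := by nlinarith
    calc ‖G D‖ ≤ (averagingConst s C * S ^ 2 + C * S + S) / (1 - η) := b4
      _ ≤ (averagingConst s C * S + C * S + S) / (1 - η) := by gcongr
      _ = (averagingConst s C + C + 1) / (1 - η) * S := by ring
      _ ≤ _ := le_add_of_nonneg_right (by positivity)
  · calc ‖G D‖ ≤ sizeConst s L C := hsize
      _ ≤ sizeConst s L C * S := le_mul_of_one_le_right hSz h1
      _ ≤ _ := le_add_of_nonneg_left (by positivity)

theorem quadraticConst_nonneg (hs0 : 0 ≤ s) (hs : s < 1) (hL : 0 ≤ L) (hC : 0 ≤ C)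
    (hsC : s * C * max 1 L < 1) : 0 ≤ quadraticConst s L C := by
  have : 0 < 1 - s * C * max 1 L := by linarith
  have := averagingConst_nonneg hs hC
  unfold quadraticConst sizeConst
  positivity

theorem quarticConst_nonneg (hs0 : 0 ≤ s) (hs : s < 1) (hL : 0 ≤ L) (hC : 0 ≤ C)
    (hsC : s * C * max 1 L < 1) : 0 ≤ quarticConst s L C := by
  have := averagingConst_nonneg hs hC
  have := quadraticConst_nonneg hs0 hs hL hC hsC
  unfold quarticConst sizeConst
  positivity

/-- The recursion with the sharp factor `1 - σ`. It comes from replacing `h` by the Picard iterate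
`t`, whose norm is at most `σ`: by skew symmetry `B(D, h, D) = B(D, t, D) - B(D, t - u, D)`, and
the second term is of higher order. -/
theorem IsMixedStep.recursion (hB : IsNormalizedFlow G B F σ) (hσ : σ ≤ s) (hs : s < 1)
    (hL : 0 ≤ L) (hsC : s * C * max 1 L < 1)
    (hm : IsMixedStep G B F Y (L * σ) C β a b h₀ h₁ h₂ u₀ u₁ u₂ t₀ t₁ t₂ y h u t) :
    (1 - σ) * ‖G (u - h)‖ ≤ β * σ * ‖G y‖ +
      (1 - β) * (|1 - a - b| * ‖G (u₀ - h₀)‖ ^ 2 + |a| * ‖G (u₁ - h₁)‖ ^ 2 +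
        |b| * ‖G (u₂ - h₂)‖ ^ 2) +
      quarticConst s L C *
        (‖G (u₀ - h₀)‖ ^ 2 + ‖G (u₁ - h₁)‖ ^ 2 + ‖G (u₂ - h₂)‖ ^ 2) ^ 2 := by
  have en := hm.energy_le hB hσ hs
  have hsize := hm.norm_sub_le_size hB hσ hL
  have hquad := hm.norm_sub_le_quadratic hB hσ hs hL hsC
  have hy := hm.optimal.trans (hm.newton₀.norm_residual_le hB hm.picard₀)
  have hw := hm.newton.norm_residual_le hB hm.picard
  have hz := hm.newton.norm_le_mul' hB hm.picard
  have ht := hm.picard.norm_le hB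
  have hσ0 := hB.nonneg
  have hs0 : 0 ≤ s := hσ0.trans hσ
  have hβ := hm.nonneg
  have hβ' := hm.le_one
  have hu : ‖G u‖ ≤ L * s := hm.size.trans (by gcongr)
  have hC : 0 ≤ C := by
    linarith [hm.coeff, abs_nonneg (1 - a - b), abs_nonneg a, abs_nonneg b]
  have hQ := quadraticConst_nonneg hs0 hs hL hC hsC
  have hA := averagingConst_nonneg hs hC
  have hSz : 0 ≤ sizeConst s L C := (norm_nonneg _).trans hsize
  have hQ4 := quarticConst_nonneg hs0 hs hL hC hsC
  have id1 : B (u - h) h (u - h) = B (u - h) t (u - h) - B (u - h) (t - u) (u - h) := by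
    have e := hB.self (u - h) (u - h)
    simp only [map_sub, LinearMap.sub_apply] at e ⊢
    linarith
  have id2 : B y h (u - h) = B y t (u - h) - B y (t - h) (u - h) := by
    simp only [map_sub, LinearMap.sub_apply]
    ring
  rw [id1, id2] at en
  set D := u - h
  set d₀ := ‖G (u₀ - h₀)‖ ^ 2
  set d₁ := ‖G (u₁ - h₁)‖ ^ 2
  set d₂ := ‖G (u₂ - h₂)‖ ^ 2
  have n₀ : 0 ≤ d₀ := by positivity
  have n₁ : 0 ≤ d₁ := by positivity
  have n₂ : 0 ≤ d₂ := by positivity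
  set T := |1 - a - b| * d₀ + |a| * d₁ + |b| * d₂
  have hT : 0 ≤ T := by positivity
  set S := d₀ + d₁ + d₂ with hS
  have hSn : 0 ≤ S := by positivity
  set Q := quadraticConst s L C
  have b1 : -(B D t D) ≤ σ * ‖G D‖ * ‖G D‖ := by
    calc -(B D t D) ≤ |B D t D| := neg_le_abs _
      _ ≤ ‖G D‖ * ‖G t‖ * ‖G D‖ := hB.abs_le _ _ _
      _ ≤ ‖G D‖ * σ * ‖G D‖ := by gcongr
      _ = _ := by ring
  have b2 : B D (t - u) D ≤ sizeConst s L C * Q ^ 2 * S ^ 2 * ‖G D‖ := by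
    calc B D (t - u) D ≤ |B D (t - u) D| := le_abs_self _
      _ ≤ ‖G D‖ * ‖G (t - u)‖ * ‖G D‖ := hB.abs_le _ _ _
      _ ≤ ‖G D‖ * ‖G D‖ ^ 2 * ‖G D‖ := by gcongr
      _ ≤ sizeConst s L C * (Q * S) ^ 2 * ‖G D‖ := by gcongr
      _ = _ := by ring
  have b3 : -(β * B y t D) ≤ β * σ * ‖G y‖ * ‖G D‖ := by
    calc -(β * B y t D) ≤ |β * B y t D| := neg_le_abs _
      _ = β * |B y t D| := by rw [abs_mul, abs_of_nonneg hβ]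
      _ ≤ β * (‖G y‖ * ‖G t‖ * ‖G D‖) := by gcongr; exact hB.abs_le _ _ _
      _ ≤ β * (‖G y‖ * σ * ‖G D‖) := by gcongr
      _ = _ := by ring
  have b4 : β * B y (t - h) D ≤ (2 + s + L * s) * Q * S ^ 2 * ‖G D‖ := by
    calc β * B y (t - h) D ≤ |β * B y (t - h) D| := le_abs_self _
      _ = β * |B y (t - h) D| := by rw [abs_mul, abs_of_nonneg hβ]
      _ ≤ 1 * (‖G y‖ * ‖G (t - h)‖ * ‖G D‖) := by gcongr; exact hB.abs_le _ _ _
      _ ≤ 1 * (S * ((2 + s + L * s) * (Q * S)) * ‖G D‖) := by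
          gcongr
          · linarith
          · refine hz.trans ?_
            gcongr
      _ = _ := by ring
  have total : (1 - σ) * ‖G D‖ * ‖G D‖ ≤ (β * σ * ‖G y‖ + (1 - β) * T +
      quarticConst s L C * S ^ 2) * ‖G D‖ := by
    rw [quarticConst]
    linarith
  rcases (norm_nonneg (G D)).eq_or_lt with h0 | h0
  · rw [← h0, mul_zero]
    have : 0 ≤ 1 - β := by linarith
    positivity
  · exact le_of_mul_le_mul_right total h0

end OneStep

/-! ### The iteration in the velocity space -/

section Iteration

theorem hMinusOneNorm_nonneg {d : ℕ} {Ω : Set (Pt d)} (f : H10 Ω →ₗ[ℝ] ℝ) :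
    0 ≤ hMinusOneNorm f :=
  Real.sInf_nonneg fun _ hF => hF.1

theorem abs_apply_le_hMinusOneNorm {d : ℕ} {Ω : Set (Pt d)} {f : H10 Ω →ₗ[ℝ] ℝ}
    (hf : MemHMinusOne f) (v : H10 Ω) : |f v| ≤ hMinusOneNorm f * ‖grad v‖ := by
  obtain ⟨F₀, hF₀⟩ := hf
  rcases (norm_nonneg (grad v)).eq_or_lt with h | h
  · have := hF₀ v
    rw [← h, mul_zero] at this ⊢
    exact this
  · rw [← div_le_iff₀ h]
    refine le_csInf ⟨|F₀|, abs_nonneg _, fun w => (hF₀ w).trans ?_⟩ fun F hF => ?_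
    · gcongr
      exact le_abs_self _
    · rw [div_le_iff₀ h]
      exact hF.2 v

theorem sigma_nonneg {d : ℕ} {Ω : Set (Pt d)} {M : ℝ} (hM0 : 0 < M) (ν : ℝ)
    (f : H10 Ω →ₗ[ℝ] ℝ) : 0 ≤ sigma M ν f := by
  have := hMinusOneNorm_nonneg f
  unfold sigma
  positivity

variable {d : ℕ} {Ω : Set (Pt d)} {M ν : ℝ} {Y : Submodule ℝ (H10 Ω)} {f : H10 Ω →ₗ[ℝ] ℝ}
  {β α₁ α₂ : ℕ → ℝ} {ut uh u : ℕ → H10 Ω}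

/-- Scaling the gradient by `M / ν` and the equation by `(M / ν)² / ν` normalizes the problem. -/
theorem isNormalizedFlow (hd : d = 2 ∨ d = 3) (hM0 : 0 < M) (hM : IsTrilinearBound Ω M)
    (hν : 0 < ν) (hf : MemHMinusOne f) :
    IsNormalizedFlow ((M / ν) • grad) (((M / ν) ^ 2 / ν) • bstarLin hd)
      (fun v => (M / ν) ^ 2 / ν * f v) (sigma M ν f) where
  abs_le v w z := by
    simp only [LinearMap.smul_apply, bstarLin_apply, norm_smul, smul_eq_mul, abs_mul]
    rw [abs_of_pos (show 0 < (M / ν) ^ 2 / ν by positivity), Real.norm_of_nonneg (by positivity)]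
    calc _ ≤ (M / ν) ^ 2 / ν * (M * ‖grad v‖ * ‖grad w‖ * ‖grad z‖) := by
          gcongr
          exact abs_bstar_le hd hM v w z
      _ = _ := by ring
  self v w := by simp [bstar_self hd hM0 hM]
  load_le v := by
    simp only [LinearMap.smul_apply, norm_smul, abs_mul]
    rw [abs_of_pos (show 0 < (M / ν) ^ 2 / ν by positivity), Real.norm_of_nonneg (by positivity)]
    calc _ ≤ (M / ν) ^ 2 / ν * (hMinusOneNorm f * ‖grad v‖) := by
          gcongr
          exact abs_apply_le_hMinusOneNorm hf v
      _ = _ := by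
          rw [sigma]
          field_simp
  nonneg := sigma_nonneg hM0 ν f

namespace IsAAPicardNewton2

theorem mixed_mem (it : IsAAPicardNewton2 Y ν f β α₁ α₂ ut uh u) (k : ℕ) : uh (k + 1) ∈ Y := by
  have hu : ∀ n, u n ∈ Y := fun n => by
    cases n with
    | zero => exact it.init_mem
    | succ n => exact it.newton_mem n
  have hut : ∀ n, n ≠ 0 → ut n ∈ Y := fun n hn => by
    obtain ⟨m, rfl⟩ := Nat.exists_eq_succ_of_ne_zero hn
    exact it.picard_mem m
  -- `ũ_0` occurs in the first two steps, with coefficient zero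
  have h₁ : α₁ (k + 1) • ut k ∈ Y := by
    rcases eq_or_ne k 0 with rfl | hk
    · simp [it.start_one]
    · exact Y.smul_mem _ (hut k hk)
  have h₂ : α₂ (k + 1) • ut (k - 1) ∈ Y := by
    match k with
    | 0 => simp [it.start_two.1]
    | 1 => simp [it.start_two.2]
    | k + 2 => exact Y.smul_mem _ (hut _ (by simp))
  rw [it.mixing]
  refine Y.add_mem (Y.smul_mem _ ?_) (Y.smul_mem _ ?_)
  · exact Y.add_mem (Y.add_mem (Y.smul_mem _ (it.picard_mem k)) h₁) h₂
  · exact Y.add_mem (Y.add_mem (Y.smul_mem _ (hu _)) (Y.smul_mem _ (hu _))) (Y.smul_mem _ (hu _))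

theorem isPicardStep (hd : d = 2 ∨ d = 3) (hν : 0 < ν)
    (it : IsAAPicardNewton2 Y ν f β α₁ α₂ ut uh u) (k : ℕ) :
    IsPicardStep ((M / ν) • grad) (((M / ν) ^ 2 / ν) • bstarLin hd)
      (fun v => (M / ν) ^ 2 / ν * f v) Y (u k) (ut (k + 1)) where
  mem := it.picard_mem k
  eq v hv := by
    simp only [LinearMap.smul_apply, bstarLin_apply, real_inner_smul_left, real_inner_smul_right,
      smul_eq_mul, ← it.picard k v hv]
    field_simp

theorem isNewtonStep (hd : d = 2 ∨ d = 3) (hν : 0 < ν)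
    (it : IsAAPicardNewton2 Y ν f β α₁ α₂ ut uh u) (k : ℕ) :
    IsNewtonStep ((M / ν) • grad) (((M / ν) ^ 2 / ν) • bstarLin hd)
      (fun v => (M / ν) ^ 2 / ν * f v) Y (uh (k + 1)) (u (k + 1)) where
  mem_left := it.mixed_mem k
  mem := it.newton_mem k
  eq v hv := by
    simp only [LinearMap.smul_apply, bstarLin_apply, real_inner_smul_left, real_inner_smul_right,
      smul_eq_mul, ← it.newton k v hv]
    field_simp

theorem norm_aaResidual_le (it : IsAAPicardNewton2 Y ν f β α₁ α₂ ut uh u) (k : ℕ) :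
    ‖grad (aaResidual ut u (k + 1) (α₁ (k + 1)) (α₂ (k + 1)))‖ ≤
      ‖grad (picardResidual ut u (k + 1))‖ := by
  have h := it.minimizes k 0 0 (fun _ => rfl) (fun _ => rfl)
  rwa [show aaResidual ut u (k + 1) 0 0 = picardResidual ut u (k + 1) by
    simp [aaResidual, comb3]] at h

theorem gain2_mul (it : IsAAPicardNewton2 Y ν f β α₁ α₂ ut uh u) (k : ℕ) :
    gain2 ut u (k + 1) (α₁ (k + 1)) (α₂ (k + 1)) * ‖grad (picardResidual ut u (k + 1))‖ =
      ‖grad (aaResidual ut u (k + 1) (α₁ (k + 1)) (α₂ (k + 1)))‖ := by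
  refine div_mul_cancel_of_imp fun h => ?_
  exact le_antisymm (h ▸ it.norm_aaResidual_le k) (norm_nonneg _)

end IsAAPicardNewton2

variable {s L C : ℝ}

theorem norm_smul_grad (hM0 : 0 < M) (hν : 0 < ν) (v : H10 Ω) :
    ‖((M / ν) • grad : H10 Ω →ₗ[ℝ] L2Mat Ω) v‖ = M / ν * ‖grad v‖ := by
  rw [LinearMap.smul_apply, norm_smul, Real.norm_of_nonneg (by positivity)]

theorem norm_smul_grad_le (hM0 : 0 < M) (hν : 0 < ν)
    (hu : ∀ k, ‖grad (u (k + 1))‖ ≤ L * ν⁻¹ * hMinusOneNorm f) (k : ℕ) :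
    ‖((M / ν) • grad : H10 Ω →ₗ[ℝ] L2Mat Ω) (u (k + 1))‖ ≤ L * sigma M ν f := by
  rw [norm_smul_grad hM0 hν]
  calc _ ≤ M / ν * (L * ν⁻¹ * hMinusOneNorm f) := by gcongr; exact hu k
    _ = _ := by
      rw [sigma]
      field_simp

theorem IsAAPicardNewton2.isMixedStep (hd : d = 2 ∨ d = 3) (hM0 : 0 < M) (hν : 0 < ν)
    (it : IsAAPicardNewton2 Y ν f β α₁ α₂ ut uh u)
    (hα : ∀ k, |1 - α₁ (k + 1) - α₂ (k + 1)| + |α₁ (k + 1)| + |α₂ (k + 1)| ≤ C)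
    (hu : ∀ k, ‖grad (u (k + 1))‖ ≤ L * ν⁻¹ * hMinusOneNorm f) (m : ℕ) :
    IsMixedStep ((M / ν) • grad) (((M / ν) ^ 2 / ν) • bstarLin hd)
      (fun v => (M / ν) ^ 2 / ν * f v) Y (L * sigma M ν f) C (β (m + 4)) (α₁ (m + 4))
      (α₂ (m + 4)) (uh (m + 3)) (uh (m + 2)) (uh (m + 1)) (u (m + 3)) (u (m + 2)) (u (m + 1))
      (ut (m + 4)) (ut (m + 3)) (ut (m + 2))
      (aaResidual ut u (m + 4) (α₁ (m + 4)) (α₂ (m + 4))) (uh (m + 4)) (u (m + 4))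
      (ut (m + 5)) where
  newton₀ := it.isNewtonStep hd hν (m + 2)
  newton₁ := it.isNewtonStep hd hν (m + 1)
  newton₂ := it.isNewtonStep hd hν m
  picard₀ := it.isPicardStep hd hν (m + 3)
  picard₁ := it.isPicardStep hd hν (m + 2)
  picard₂ := it.isPicardStep hd hν (m + 1)
  residual := rfl
  mixed := by
    have h := it.mixing (m + 3)
    rw [h]
    simp only [aaResidual, picardResidual, comb3,
      show m + 3 - 1 = m + 2 from rfl, show m + 3 - 2 = m + 1 from rfl,
      show m + 3 + 1 - 2 = m + 2 from rfl, show m + 4 - 1 = m + 3 from rfl,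
      show m + 2 - 1 = m + 1 from rfl,
      show m + 3 + 1 = m + 4 from rfl]
    module
  newton := it.isNewtonStep hd hν (m + 3)
  picard := it.isPicardStep hd hν (m + 4)
  nonneg := (it.damping (m + 3)).1.le
  le_one := (it.damping (m + 3)).2
  coeff := hα (m + 3)
  optimal := by
    rw [norm_smul_grad hM0 hν, norm_smul_grad hM0 hν]
    exact mul_le_mul_of_nonneg_left (it.norm_aaResidual_le (m + 3)) (by positivity)
  size₀ := norm_smul_grad_le hM0 hν hu (m + 2)
  size₁ := norm_smul_grad_le hM0 hν hu (m + 1)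
  size₂ := norm_smul_grad_le hM0 hν hu m
  size := norm_smul_grad_le hM0 hν hu (m + 3)

/-- Equivalence of the residuals of the Newton and of the following Picard step. -/
theorem IsAAPicardNewton2.norm_newton_le_err (hd : d = 2 ∨ d = 3) (hM0 : 0 < M)
    (hM : IsTrilinearBound Ω M) (hν : 0 < ν) (hf : MemHMinusOne f) (hσ : sigma M ν f ≤ s)
    (hL : 0 ≤ L) (it : IsAAPicardNewton2 Y ν f β α₁ α₂ ut uh u)
    (hu : ∀ k, ‖grad (u (k + 1))‖ ≤ L * ν⁻¹ * hMinusOneNorm f) (k : ℕ) :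
    ‖grad (u (k + 1) - uh (k + 1))‖ ≤ (1 + L * s) * err ut uh (k + 2) := by
  have h := (it.isNewtonStep (M := M) hd hν k).norm_le_mul (isNormalizedFlow hd hM0 hM hν hf)
    (it.isPicardStep hd hν (k + 1))
  have h2 := (norm_smul_grad_le hM0 hν hu k).trans (mul_le_mul_of_nonneg_left hσ hL)
  rw [norm_smul_grad hM0 hν (u (k + 1) - uh (k + 1)),
    norm_smul_grad hM0 hν (ut (k + 1 + 1) - uh (k + 1))] at h
  refine le_of_mul_le_mul_left (h.trans ?_) (show 0 < M / ν by positivity)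
  rw [mul_left_comm (M / ν) (1 + L * s)]
  exact mul_le_mul_of_nonneg_right (by linarith) (mul_nonneg (by positivity) (norm_nonneg _))

theorem IsAAPicardNewton2.err_le_norm_newton (hd : d = 2 ∨ d = 3) (hM0 : 0 < M)
    (hM : IsTrilinearBound Ω M) (hν : 0 < ν) (hf : MemHMinusOne f) (hσ : sigma M ν f ≤ s)
    (hL : 0 ≤ L) (it : IsAAPicardNewton2 Y ν f β α₁ α₂ ut uh u)
    (hu : ∀ k, ‖grad (u (k + 1))‖ ≤ L * ν⁻¹ * hMinusOneNorm f) (k : ℕ) :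
    err ut uh (k + 2) ≤ (2 + s + L * s) * ‖grad (u (k + 1) - uh (k + 1))‖ := by
  have h := (it.isNewtonStep (M := M) hd hν k).norm_le_mul' (isNormalizedFlow hd hM0 hM hν hf)
    (it.isPicardStep hd hν (k + 1))
  have h2 := (norm_smul_grad_le hM0 hν hu k).trans (mul_le_mul_of_nonneg_left hσ hL)
  rw [norm_smul_grad hM0 hν (u (k + 1) - uh (k + 1)),
    norm_smul_grad hM0 hν (ut (k + 1 + 1) - uh (k + 1))] at h
  refine le_of_mul_le_mul_left (h.trans ?_) (show 0 < M / ν by positivity)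
  rw [mul_left_comm (M / ν)]
  gcongr

/-- The factor in the higher order terms. -/
def remainderConst (s L C : ℝ) : ℝ :=
  1 + (2 + s + L * s) / (1 - s) * (quarticConst s L C * (3 * (1 + L * s) ^ 4))

theorem err_nonneg (j : ℕ) : 0 ≤ err ut uh j := norm_nonneg _

theorem gain2_nonneg (n : ℕ) (a b : ℝ) : 0 ≤ gain2 ut u n a b :=
  div_nonneg (norm_nonneg _) (norm_nonneg _)

/-- The three fourth powers in the higher order terms. -/
theorem quartic_le_higherOrder (hM0 : 0 < M) (hν : 0 < ν) {K : ℝ} (hK : 0 ≤ K) (m : ℕ) :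
    ν * M⁻¹ * ((K * (ν⁻¹ * M) * err ut uh (m + 4)) ^ 4 +
      (K * (ν⁻¹ * M) * err ut uh (m + 3)) ^ 4 + (K * (ν⁻¹ * M) * err ut uh (m + 2)) ^ 4) ≤
      higherOrder K M ν ut uh u (m + 4) := by
  have he : ∀ j, 0 ≤ K * (ν⁻¹ * M) * err ut uh j := fun j =>
    mul_nonneg (by positivity) (err_nonneg j)
  rw [higherOrder]
  refine mul_le_mul_of_nonneg_left ?_ (by positivity)
  refine le_add_of_le_of_nonneg ?_ (by positivity)
  have hsub : ({m + 4, m + 3, m + 2} : Finset ℕ) ⊆ Finset.Icc 2 (m + 4) := by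
    intro j hj
    simp only [Finset.mem_insert, Finset.mem_singleton] at hj
    rw [Finset.mem_Icc]
    omega
  refine le_trans (le_of_eq ?_) (Finset.sum_le_sum_of_subset_of_nonneg hsub
    fun j _ _ => pow_nonneg (he j) _)
  rw [Finset.sum_insert (by simp), Finset.sum_insert (by simp), Finset.sum_singleton,
    show (m + 4 - 1 - (m + 4)) / 2 = 0 by omega, show (m + 4 - 1 - (m + 3)) / 2 = 0 by omega,
    show (m + 4 - 1 - (m + 2)) / 2 = 0 by omega]
  norm_num
  ring

/-- The arithmetic of the recursion: the coefficients are replaced by their bound `C`, and the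
quartic terms are expressed by the `e_i`. -/
theorem mul_le_of_recursion {c r R σ s β θ C κ A K a₀ a₁ a₂ w y d₀ d₁ d₂ e₀ e₁ e₂ : ℝ}
    (hc : 0 < c) (hr : 0 ≤ r) (hr' : r ≤ R) (hσ0 : 0 ≤ σ) (hσ : σ ≤ s) (hs : s < 1) (hβ : 0 ≤ β)
    (hβ' : 0 ≤ 1 - β) (hθ : 0 ≤ θ) (hκ : 0 ≤ κ) (n₀ : 0 ≤ d₀) (n₁ : 0 ≤ d₁) (n₂ : 0 ≤ d₂)
    (ha₀ : a₀ ≤ C) (ha₁ : a₁ ≤ C) (ha₂ : a₂ ≤ C) (hw : c * w ≤ (c * d₀) ^ 2)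
    (x₀ : d₀ ≤ A * e₀) (x₁ : d₁ ≤ A * e₁) (x₂ : d₂ ≤ A * e₂)
    (hK : K = 1 + R / (1 - s) * (κ * (3 * A ^ 4)))
    (hrec : (1 - σ) * (c * y) ≤ β * σ * (c * (θ * w)) +
      (1 - β) * (a₀ * (c * d₀) ^ 2 + a₁ * (c * d₁) ^ 2 + a₂ * (c * d₂) ^ 2) +
      κ * ((c * d₀) ^ 2 + (c * d₁) ^ 2 + (c * d₂) ^ 2) ^ 2) :
    r * y ≤ c * r / (1 - σ) * ((β * σ * θ + (1 - β) * C) * d₀ ^ 2 +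
        (1 - β) * C * (d₁ ^ 2 + d₂ ^ 2)) +
      c⁻¹ * ((K * c * e₀) ^ 4 + (K * c * e₁) ^ 4 + (K * c * e₂) ^ 4) := by
  have hR : 0 ≤ R := hr.trans hr'
  have hs' : 0 < 1 - s := by linarith
  have hσ' : 0 < 1 - σ := by linarith
  have hpow : 0 ≤ R / (1 - s) * (κ * (3 * A ^ 4)) := by positivity
  have hK1 : 1 ≤ K := by linarith
  -- the principal part
  have main : (1 - σ) * y ≤ c * ((β * σ * θ + (1 - β) * C) * d₀ ^ 2 +
      (1 - β) * C * (d₁ ^ 2 + d₂ ^ 2)) +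
      κ * c ^ 3 * (d₀ ^ 2 + d₁ ^ 2 + d₂ ^ 2) ^ 2 := by
    refine le_of_mul_le_mul_left ?_ hc
    have i₀ : β * σ * (θ * (c * w)) ≤ β * σ * (θ * (c * d₀) ^ 2) := by gcongr
    have i₁ : a₀ * (c * d₀) ^ 2 ≤ C * (c * d₀) ^ 2 := by
      gcongr
    have i₂ : a₁ * (c * d₁) ^ 2 ≤ C * (c * d₁) ^ 2 := by gcongr
    have i₃ : a₂ * (c * d₂) ^ 2 ≤ C * (c * d₂) ^ 2 := by gcongr
    have i₄ := mul_le_mul_of_nonneg_left (add_le_add (add_le_add i₁ i₂) i₃) hβ'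
    linarith
  -- the remainder
  have quart : (d₀ ^ 2 + d₁ ^ 2 + d₂ ^ 2) ^ 2 ≤
      3 * A ^ 4 * (e₀ ^ 4 + e₁ ^ 4 + e₂ ^ 4) := by
    have f₀ : d₀ ^ 4 ≤ (A * e₀) ^ 4 := by gcongr
    have f₁ : d₁ ^ 4 ≤ (A * e₁) ^ 4 := by gcongr
    have f₂ : d₂ ^ 4 ≤ (A * e₂) ^ 4 := by gcongr
    have := sq_nonneg (d₀ ^ 2 - d₁ ^ 2)
    have := sq_nonneg (d₀ ^ 2 - d₂ ^ 2)
    have := sq_nonneg (d₁ ^ 2 - d₂ ^ 2)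
    calc _ ≤ 3 * (d₀ ^ 4 + d₁ ^ 4 + d₂ ^ 4) := by linarith
      _ ≤ 3 * ((A * e₀) ^ 4 + (A * e₁) ^ 4 + (A * e₂) ^ 4) := by
        linarith
      _ = _ := by ring
  have hK4 : r / (1 - σ) * (κ * (3 * A ^ 4)) ≤ K ^ 4 := by
    calc _ ≤ R / (1 - s) * (κ * (3 * A ^ 4)) := by
          gcongr
      _ ≤ K := by linarith
      _ ≤ K ^ 4 := le_self_pow₀ hK1 (by norm_num)
  have rem : r / (1 - σ) * (κ * c ^ 3 * (d₀ ^ 2 + d₁ ^ 2 + d₂ ^ 2) ^ 2) ≤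
      c⁻¹ * ((K * c * e₀) ^ 4 + (K * c * e₁) ^ 4 + (K * c * e₂) ^ 4) := by
    calc _ ≤ r / (1 - σ) * (κ * c ^ 3 *
          (3 * A ^ 4 * (e₀ ^ 4 + e₁ ^ 4 + e₂ ^ 4))) := by gcongr
      _ = r / (1 - σ) * (κ * (3 * A ^ 4)) *
          (c ^ 3 * (e₀ ^ 4 + e₁ ^ 4 + e₂ ^ 4)) := by ring
      _ ≤ K ^ 4 * (c ^ 3 * (e₀ ^ 4 + e₁ ^ 4 + e₂ ^ 4)) := by gcongr
      _ = _ := by field_simp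
  have hmul := mul_le_mul_of_nonneg_left main (show 0 ≤ r / (1 - σ) by positivity)
  rw [mul_add, ← mul_assoc, div_mul_cancel₀ _ hσ'.ne'] at hmul
  exact hmul.trans (add_le_add (le_of_eq (by ring)) rem)

/-- The recursion for the ratio `r` times `‖∇(u_k - û_k)‖`, with the predecessors still expressed
by `‖∇(u_j - û_j)‖`. -/
theorem IsAAPicardNewton2.ratio_mul_norm_newton_le (hd : d = 2 ∨ d = 3) (hM0 : 0 < M)
    (hM : IsTrilinearBound Ω M) (hν : 0 < ν) (hf : MemHMinusOne f) (hσ : sigma M ν f ≤ s)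
    (hs : s < 1) (hL : 0 ≤ L) (hsC : s * C * max 1 L < 1)
    (it : IsAAPicardNewton2 Y ν f β α₁ α₂ ut uh u)
    (hα : ∀ k, |1 - α₁ (k + 1) - α₂ (k + 1)| + |α₁ (k + 1)| + |α₂ (k + 1)| ≤ C)
    (hu : ∀ k, ‖grad (u (k + 1))‖ ≤ L * ν⁻¹ * hMinusOneNorm f) (m : ℕ) {r : ℝ} (hr : 0 ≤ r)
    (hr' : r ≤ 2 + s + L * s) :
    r * ‖grad (u (m + 4) - uh (m + 4))‖ ≤
      ν⁻¹ * M * r / (1 - sigma M ν f) *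
        ((β (m + 4) * sigma M ν f * gain2 ut u (m + 4) (α₁ (m + 4)) (α₂ (m + 4)) +
            (1 - β (m + 4)) * C) * ‖grad (u (m + 3) - uh (m + 3))‖ ^ 2 +
          (1 - β (m + 4)) * C * (‖grad (u (m + 2) - uh (m + 2))‖ ^ 2 +
            ‖grad (u (m + 1) - uh (m + 1))‖ ^ 2)) +
      higherOrder (remainderConst s L C) M ν ut uh u (m + 4) := by
  have hB := isNormalizedFlow hd hM0 hM hν hf
  have hm := it.isMixedStep hd hM0 hν hα hu m
  have hrec := hm.recursion hB hσ hs hL hsC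
  have hw := hm.newton₀.norm_residual_le hB hm.picard₀
  simp only [norm_smul_grad hM0 hν] at hrec hw
  have hg := it.gain2_mul (m + 3)
  have hθ := gain2_nonneg (ut := ut) (u := u) (m + 4) (α₁ (m + 4)) (α₂ (m + 4))
  have x₀ := it.norm_newton_le_err hd hM0 hM hν hf hσ hL hu (m + 2)
  have x₁ := it.norm_newton_le_err hd hM0 hM hν hf hσ hL hu (m + 1)
  have x₂ := it.norm_newton_le_err hd hM0 hM hν hf hσ hL hu m
  have hσ0 := sigma_nonneg hM0 ν f
  have hs0 : 0 ≤ s := hσ0.trans hσ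
  have hcoeff := hm.coeff
  have ha0 := abs_nonneg (1 - α₁ (m + 4) - α₂ (m + 4))
  have ha1 := abs_nonneg (α₁ (m + 4))
  have ha2 := abs_nonneg (α₂ (m + 4))
  have hC : 0 ≤ C := by linarith
  have hQ := quarticConst_nonneg (s := s) hs0 hs hL hC hsC
  have hs' : 0 < 1 - s := by linarith
  have hK1 : 1 ≤ remainderConst s L C := le_add_of_nonneg_right (by positivity)
  refine le_trans ?_ (add_le_add_right
    (quartic_le_higherOrder (u := u) hM0 hν (zero_le_one.trans hK1) m) _)
  change gain2 ut u (m + 4) (α₁ (m + 4)) (α₂ (m + 4)) * ‖grad (ut (m + 4) - u (m + 3))‖ =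
    ‖grad (aaResidual ut u (m + 4) (α₁ (m + 4)) (α₂ (m + 4)))‖ at hg
  rw [← hg] at hrec
  rw [show ν⁻¹ * M = M / ν by ring, show ν * M⁻¹ = (M / ν)⁻¹ by rw [inv_div]; rfl]
  exact mul_le_of_recursion (by positivity) hr hr' hσ0 hσ hs hm.nonneg (sub_nonneg.2 hm.le_one)
    hθ hQ (norm_nonneg _) (norm_nonneg _) (norm_nonneg _) (by linarith) (by linarith)
    (by linarith) hw x₀ x₁ x₂ rfl hrec

/-! ### The gain of depth two -/

/-- If two elements minimize the norm over a set containing their midpoint, they agree. -/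
theorem eq_of_norm_eq_of_norm_le_midpoint {E : Type*} [NormedAddCommGroup E]
    [InnerProductSpace ℝ E] {x y : E} (hxy : ‖y‖ ≤ ‖x‖) (hx : ‖x‖ ≤ ‖(1 / 2 : ℝ) • (x + y)‖) :
    x = y := by
  have h := parallelogram_law_with_norm ℝ x y
  rw [norm_smul, Real.norm_of_nonneg (by norm_num)] at hx
  have h0 : ‖x - y‖ * ‖x - y‖ ≤ 0 := by nlinarith [norm_nonneg x, norm_nonneg y]
  exact sub_eq_zero.1 (norm_eq_zero.1 (mul_self_eq_zero.1 (le_antisymm h0 (by positivity))))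

/-- The distance from a point to a line is attained. -/
theorem exists_norm_sub_smul_le {E : Type*} [NormedAddCommGroup E] [InnerProductSpace ℝ E]
    (x y : E) : ∃ c : ℝ, ∀ a : ℝ, ‖x - c • y‖ ≤ ‖x - a • y‖ := by
  rcases eq_or_ne y 0 with rfl | hy
  · exact ⟨0, by simp⟩
  have hy' : inner ℝ y y ≠ 0 := inner_self_ne_zero.2 hy
  refine ⟨inner ℝ x y / inner ℝ y y, fun a => ?_⟩
  set c := inner ℝ x y / inner ℝ y y
  have orth : inner ℝ (x - c • y) ((c - a) • y) = 0 := by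
    rw [real_inner_smul_right, inner_sub_left, real_inner_smul_left, div_mul_cancel₀ _ hy',
      sub_self, mul_zero]
  have e : x - a • y = (x - c • y) + (c - a) • y := by module
  rw [e]
  have := norm_add_sq_eq_norm_sq_add_norm_sq_of_inner_eq_zero _ _ orth
  exact le_of_sq_le_sq (by nlinarith [norm_nonneg ((c - a) • y)]) (norm_nonneg _)

theorem grad_aaResidual (n : ℕ) (a b : ℝ) :
    grad (aaResidual ut u n a b) = grad (picardResidual ut u n) -
      (a + b) • grad (picardResidual ut u n - picardResidual ut u (n - 1)) -
      b • grad (picardResidual ut u (n - 1) - picardResidual ut u (n - 2)) := by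
  rw [← map_smul, ← map_smul, ← map_sub, ← map_sub]
  congr 1
  rw [aaResidual, comb3]
  module

/-- Depth two improves strictly on depth one when `α² ≠ 0`: otherwise two different points of the
plane of admissible residuals would have minimal norm. -/
theorem IsAAPicardNewton2.gain2_lt_gain1 (it : IsAAPicardNewton2 Y ν f β α₁ α₂ ut uh u) {k : ℕ}
    (hk : 2 ≤ k) (hα : α₂ (k + 1) ≠ 0)
    (hli : LinearIndependent ℝ
      ![grad (picardResidual ut u (k + 1) - picardResidual ut u k),
        grad (picardResidual ut u k - picardResidual ut u (k - 1))]) :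
    gain2 ut u (k + 1) (α₁ (k + 1)) (α₂ (k + 1)) < gain1 ut u (k + 1) ∧
      gain1 ut u (k + 1) ≤ 1 := by
  have hmin : ∀ a b : ℝ, ‖grad (aaResidual ut u (k + 1) (α₁ (k + 1)) (α₂ (k + 1)))‖ ≤
      ‖grad (aaResidual ut u (k + 1) a b)‖ := fun a b =>
    it.minimizes k a b (by omega) (by omega)
  have hzero : aaResidual ut u (k + 1) 0 0 = picardResidual ut u (k + 1) := by
    simp [aaResidual, comb3]
  -- no residual of depth one has minimal norm
  have hlt : ∀ a : ℝ, ‖grad (aaResidual ut u (k + 1) (α₁ (k + 1)) (α₂ (k + 1)))‖ <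
      ‖grad (aaResidual ut u (k + 1) a 0)‖ := by
    intro a
    refine lt_of_le_of_ne (hmin a 0) fun heq => hα ?_
    have mid : (1 / 2 : ℝ) • (grad (aaResidual ut u (k + 1) (α₁ (k + 1)) (α₂ (k + 1))) +
        grad (aaResidual ut u (k + 1) a 0)) =
        grad (aaResidual ut u (k + 1) ((α₁ (k + 1) + a) / 2) (α₂ (k + 1) / 2)) := by
      rw [← map_add, ← map_smul]
      congr 1
      rw [aaResidual, aaResidual, aaResidual, comb3, comb3, comb3]
      module
    have e := eq_of_norm_eq_of_norm_le_midpoint heq.ge (by rw [mid]; exact hmin _ _)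
    rw [grad_aaResidual, grad_aaResidual] at e
    have e' : (α₁ (k + 1) + α₂ (k + 1) - a) •
        grad (picardResidual ut u (k + 1) - picardResidual ut u k) +
        α₂ (k + 1) • grad (picardResidual ut u k - picardResidual ut u (k - 1)) = 0 := by
      rw [← sub_eq_zero] at e
      have e2 := neg_eq_zero.2 e
      rw [← e2]
      simp only [Nat.add_sub_cancel, show k + 1 - 2 = k - 1 by omega]
      module
    exact (LinearIndependent.pair_iff.1 hli _ _ e').2
  have hpos : 0 < ‖grad (picardResidual ut u (k + 1))‖ := by
    rw [← hzero]
    exact (norm_nonneg _).trans_lt (hlt 0)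
  have hbdd : BddBelow (Set.range fun a : ℝ => ‖grad (aaResidual ut u (k + 1) a 0)‖) :=
    ⟨0, by rintro _ ⟨a, rfl⟩; exact norm_nonneg _⟩
  constructor
  · rw [gain2, gain1]
    refine div_lt_div_of_pos_right ?_ hpos
    obtain ⟨c, hc⟩ := exists_norm_sub_smul_le (grad (picardResidual ut u (k + 1)))
      (grad (picardResidual ut u (k + 1) - picardResidual ut u k))
    refine (hlt c).trans_le (le_ciInf fun a => ?_)
    simpa [grad_aaResidual] using hc a
  · rw [gain1, div_le_one hpos]
    refine (ciInf_le hbdd 0).trans_eq ?_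
    rw [hzero]

/-! ### Assembly of the estimates -/

/-- The ratios of the residuals of the Picard and the Newton step. Where both vanish, the value of
the ratio is immaterial. -/
theorem IsAAPicardNewton2.exists_ratio (hd : d = 2 ∨ d = 3) (hM0 : 0 < M)
    (hM : IsTrilinearBound Ω M) (hν : 0 < ν) (hf : MemHMinusOne f) (hσ : sigma M ν f ≤ s)
    (hL : 0 ≤ L) (it : IsAAPicardNewton2 Y ν f β α₁ α₂ ut uh u)
    (hu : ∀ k, ‖grad (u (k + 1))‖ ≤ L * ν⁻¹ * hMinusOneNorm f) :
    ∃ r : ℕ → ℝ, ∀ j, 1 ≤ j → (1 + L * s)⁻¹ ≤ r j ∧ r j ≤ 2 + s + L * s ∧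
      err ut uh (j + 1) = r j * ‖grad (u j - uh j)‖ := by
  have hs0 : 0 ≤ s := (sigma_nonneg hM0 ν f).trans hσ
  have hLs : 0 ≤ L * s := mul_nonneg hL hs0
  refine ⟨fun j => if ‖grad (u j - uh j)‖ = 0 then 1 else
    err ut uh (j + 1) / ‖grad (u j - uh j)‖, fun j hj => ?_⟩
  obtain ⟨k, rfl⟩ := Nat.exists_eq_add_of_le' hj
  have h1 := it.norm_newton_le_err hd hM0 hM hν hf hσ hL hu k
  have h2 := it.err_le_norm_newton hd hM0 hM hν hf hσ hL hu k
  dsimp only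
  split_ifs with h0
  · refine ⟨inv_le_one_of_one_le₀ (by linarith), by linarith, ?_⟩
    rw [h0, mul_zero] at h2 ⊢
    exact le_antisymm h2 (err_nonneg _)
  · have hp : 0 < ‖grad (u (k + 1) - uh (k + 1))‖ := lt_of_le_of_ne (norm_nonneg _) (Ne.symm h0)
    refine ⟨?_, ?_, (div_mul_cancel₀ _ h0).symm⟩
    · rw [le_div_iff₀ hp, inv_mul_le_iff₀ (by linarith)]
      exact h1
    · rw [div_le_iff₀ hp]
      exact h2

end Iteration

end

theorem theorem3p2 (s L C_A : ℝ) (hs : s < 1) (hL : 0 < L) (hC_A : 0 < C_A)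
    (hsC : s * C_A * max 1 L < 1) :
    ∃ (C : ℕ → ℝ) (c₀ C₀ K : ℝ), (∀ k, 0 < C k) ∧ 0 < c₀ ∧ 0 < C₀ ∧ 0 < K ∧
      ∀ (d : ℕ), (d = 2 ∨ d = 3) →
      ∀ (Ω : Set (Pt d)), IsOpen Ω → IsConnected Ω →
      ∀ (M : ℝ), 0 < M → IsTrilinearBound Ω M →
      -- the divergence free space, or a finite dimensional (discrete) velocity space
      ∀ (Y : Submodule ℝ (H10 Ω)),
        ((Y : Set (H10 Ω)) = {v | IsDivFree v} ∨ FiniteDimensional ℝ Y) →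
      ∀ (ν : ℝ), 0 < ν → ∀ (f : H10 Ω →ₗ[ℝ] ℝ), MemHMinusOne f → sigma M ν f ≤ s →
      ∀ (β α₁ α₂ : ℕ → ℝ) (ut uh u : ℕ → H10 Ω),
        IsAAPicardNewton2 Y ν f β α₁ α₂ ut uh u →
        (∀ k, |1 - α₁ (k + 1) - α₂ (k + 1)| + |α₁ (k + 1)| + |α₂ (k + 1)| ≤ C_A) →
        (∀ k, ‖grad (u (k + 1))‖ ≤ L * ν⁻¹ * hMinusOneNorm f) →
        -- the bound with constants that do not depend on the problem
        (∀ k, 4 ≤ k → α₂ k ≠ 0 →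
          err ut uh (k + 1) ≤
            ν⁻¹ * M * (C (k - 1) ^ 2)⁻¹ * C k / (1 - sigma M ν f) *
                (β k * sigma M ν f * gain2 ut u k (α₁ k) (α₂ k) + (1 - β k) * C_A) *
                err ut uh k ^ 2 +
              (1 - β k) * (C_A * ν⁻¹ * M / (1 - sigma M ν f)) *
                ∑ j ∈ Finset.Icc (k - 2) (k - 1), (C (j - 1) ^ 2)⁻¹ * err ut uh j ^ 2 +
              higherOrder K M ν ut uh u k) ∧
        -- the bound with the ratios of the two residuals, which are uniformly bounded
        (∃ r : ℕ → ℝ,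
          (∀ j, 1 ≤ j → c₀ ≤ r j ∧ r j ≤ C₀ ∧ err ut uh (j + 1) = r j * ‖grad (u j - uh j)‖) ∧
          ∀ k, 4 ≤ k → α₂ k ≠ 0 →
            err ut uh (k + 1) ≤
              ν⁻¹ * M * (r (k - 1) ^ 2)⁻¹ * r k / (1 - sigma M ν f) *
                  (β k * sigma M ν f * gain2 ut u k (α₁ k) (α₂ k) + (1 - β k) * C_A) *
                  err ut uh k ^ 2 +
                (1 - β k) * (C_A * ν⁻¹ * M / (1 - sigma M ν f)) *
                  ∑ j ∈ Finset.Icc (k - 2) (k - 1), r k * (r (j - 1) ^ 2)⁻¹ * err ut uh j ^ 2 +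
                higherOrder K M ν ut uh u k) ∧
        -- the gain improves on that of depth 1 when the residual differences have full rank
        (∀ k, 4 ≤ k → α₂ k ≠ 0 →
          LinearIndependent ℝ ![grad (picardResidual ut u k - picardResidual ut u (k - 1)),
            grad (picardResidual ut u (k - 1) - picardResidual ut u (k - 2))] →
          gain2 ut u k (α₁ k) (α₂ k) < gain1 ut u k ∧ gain1 ut u k ≤ 1) := by
  -- the bounds depend on `s` only through `0 ≤ σ ≤ s`, so a negative `s` may be raised to zero
  obtain ⟨s', hs', hs'0, hss', hsC'⟩ :
      ∃ s' : ℝ, s' < 1 ∧ 0 ≤ s' ∧ s ≤ s' ∧ s' * C_A * max 1 L < 1 := by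
    refine ⟨max s 0, max_lt hs one_pos, le_max_right _ _, le_max_left _ _, ?_⟩
    rcases le_total s 0 with h | h
    · simp [h]
    · rwa [max_eq_left h]
  have hLs : 0 ≤ L * s' := mul_nonneg hL.le hs'0
  set c₀ := (1 + L * s')⁻¹
  set C₀ := 2 + s' + L * s'
  have c₀pos : 0 < c₀ := by positivity
  have C₀pos : 0 < C₀ := by positivity
  -- `ρ ≥ 1` exceeds all quotients `r_j / r_i²`; if all `C_i` equal `ρ⁻¹`, then so do
  -- `C_j / C_i² = ρ` and `1 / C_i² = ρ²`
  set ρ := 1 + C₀ * (c₀ ^ 2)⁻¹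
  have hρ1 : 1 ≤ ρ := le_add_of_nonneg_right (by positivity)
  have hρpos : 0 < ρ := one_pos.trans_le hρ1
  have hKpos : 0 < remainderConst s' L C_A := by
    have := quarticConst_nonneg hs'0 hs' hL.le hC_A.le hsC'
    have : 0 < 1 - s' := by linarith
    unfold remainderConst
    positivity
  refine ⟨fun _ => ρ⁻¹, c₀, C₀, remainderConst s' L C_A, fun _ => by positivity, c₀pos, C₀pos,
    hKpos, ?_⟩
  intro d hd Ω _ _ M hM0 hM Y _ ν hν f hf hσs β α₁ α₂ ut uh u it hα hu
  have hσ := hσs.trans hss'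
  have hσ0 := sigma_nonneg hM0 ν f
  have hσ' : 0 < 1 - sigma M ν f := by linarith
  obtain ⟨r, hr⟩ := it.exists_ratio hd hM0 hM hν hf hσ hL.le hu
  have hrpos : ∀ j, 1 ≤ j → 0 < r j := fun j hj => c₀pos.trans_le (hr j hj).1
  have newton_sq : ∀ j, 1 ≤ j →
      ‖grad (u j - uh j)‖ ^ 2 = (r j ^ 2)⁻¹ * err ut uh (j + 1) ^ 2 := fun j hj => by
    have := (hrpos j hj).ne'
    rw [(hr j hj).2.2]
    field_simp
  have bound : ∀ m, err ut uh (m + 5) ≤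
      ν⁻¹ * M * (r (m + 3) ^ 2)⁻¹ * r (m + 4) / (1 - sigma M ν f) *
          (β (m + 4) * sigma M ν f * gain2 ut u (m + 4) (α₁ (m + 4)) (α₂ (m + 4)) +
            (1 - β (m + 4)) * C_A) * err ut uh (m + 4) ^ 2 +
        (1 - β (m + 4)) * (C_A * ν⁻¹ * M / (1 - sigma M ν f)) *
          (r (m + 4) * (r (m + 1) ^ 2)⁻¹ * err ut uh (m + 2) ^ 2 +
            r (m + 4) * (r (m + 2) ^ 2)⁻¹ * err ut uh (m + 3) ^ 2) +
        higherOrder (remainderConst s' L C_A) M ν ut uh u (m + 4) := by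
    intro m
    have h := it.ratio_mul_norm_newton_le hd hM0 hM hν hf hσ hs' hL.le hsC' hα hu m
      (hrpos (m + 4) (by omega)).le (hr (m + 4) (by omega)).2.1
    rw [← (hr (m + 4) (by omega)).2.2, newton_sq (m + 3) (by omega), newton_sq (m + 2) (by omega),
      newton_sq (m + 1) (by omega)] at h
    exact h.trans (le_of_eq (by ring))
  have sum_two : ∀ (m : ℕ) (F : ℕ → ℝ),
      ∑ j ∈ Finset.Icc (m + 4 - 2) (m + 4 - 1), F j = F (m + 2) + F (m + 3) := fun m F => by
    rw [show m + 4 - 2 = m + 2 from rfl, show m + 4 - 1 = m + 2 + 1 from rfl,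
      Finset.sum_Icc_succ_top (by omega), Finset.Icc_self, Finset.sum_singleton]
  refine ⟨fun k hk _ => ?_, ⟨r, hr, fun k hk _ => ?_⟩, fun k hk hk2 hli => ?_⟩
  · obtain ⟨m, rfl⟩ := Nat.exists_eq_add_of_le' hk
    rw [sum_two]
    have dom : ∀ i j, 1 ≤ i → 1 ≤ j → (r i ^ 2)⁻¹ * r j ≤ C₀ * (c₀ ^ 2)⁻¹ := by
      intro i j hi hj
      rw [mul_comm]
      have := (hrpos j hj).le
      gcongr
      · exact (hr j hj).2.1
      · exact (hr i hi).1
    have dom₁ : ∀ i j, 1 ≤ i → 1 ≤ j → (r i ^ 2)⁻¹ * r j ≤ (ρ⁻¹ ^ 2)⁻¹ * ρ⁻¹ := by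
      intro i j hi hj
      rw [show (ρ⁻¹ ^ 2)⁻¹ * ρ⁻¹ = ρ by field_simp]
      exact (dom i j hi hj).trans (le_add_of_nonneg_left zero_le_one)
    have dom₂ : ∀ i j, 1 ≤ i → 1 ≤ j → r j * (r i ^ 2)⁻¹ ≤ (ρ⁻¹ ^ 2)⁻¹ := by
      intro i j hi hj
      rw [inv_pow, inv_inv, mul_comm]
      exact ((dom i j hi hj).trans (le_add_of_nonneg_left zero_le_one)).trans
        (le_self_pow₀ hρ1 two_ne_zero)
    have hβ := (it.damping (m + 3)).1.le
    have hβ' := sub_nonneg.2 (it.damping (m + 3)).2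
    have hθ := gain2_nonneg (ut := ut) (u := u) (m + 4) (α₁ (m + 4)) (α₂ (m + 4))
    refine (bound m).trans ?_
    gcongr ?_ + ?_ + _
    · rw [mul_assoc (ν⁻¹ * M), mul_assoc (ν⁻¹ * M)]
      gcongr ν⁻¹ * M * ?_ / _ * _ * _
      exact dom₁ _ _ (by omega) (by omega)
    · gcongr _ * (?_ * _ + ?_ * _)
      · exact dom₂ _ _ (by omega) (by omega)
      · exact dom₂ _ _ (by omega) (by omega)
  · obtain ⟨m, rfl⟩ := Nat.exists_eq_add_of_le' hk
    rw [sum_two]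
    exact bound m
  · obtain ⟨m, rfl⟩ := Nat.exists_eq_add_of_le' hk
    exact it.gain2_lt_gain1 (k := m + 3) (by omega) hk2 hli
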